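/- Let $\pi\colon E\to M$ be a smooth vector bundle over a smooth $n$-dimensional manifold, $J^\infty(\pi)$ its infinite jet space, $\mathcal F(\pi)$ the algebra of smooth functions of finite order on $J^\infty(\pi)$, and $\Lambda^*(\pi)$ the algebra of differential forms of finite order on it. Let $\mathcal{C}\Lambda^*(\pi)\subset\Lambda^*(\pi)$ be the ideal of forms that vanish on the Cartan planes (the planes tangent to the graphs $j^\infty\sigma$ of infinite jets of sections), and let $\Lambda^n_h(\pi)=\mathcal F(\pi)\cdot\pi_\infty^*\Lambda^n(M)$ be the horizontal $n$-forms. Let $\mathcal{E}\subset J^\infty(\pi)$ be the infinite prolongation of a system $F=0$, i.e. the set of points where $D_\alpha(F^i)=0$ for all $i$ and all multi-indices $\alpha$; here $F$ is a smooth section, of finite order, of the pullback to $J^\infty(\pi)$ of a smooth vector bundle over $M$. Let $I$ be the ideal of functions vanishing on $\mathcal{E}$. Let $\Lambda^*(\mathcal{E})$ be the quotient of $\Lambda^*(\pi)$ by the ideal generated by $I$ and $dI$, let $\mathcal{C}\Lambda^*(\mathcal{E})$ be the image of $\mathcal{C}\Lambda^*(\pi)$, and let $(E_r^{p,q}(\mathcal{E}),d_r)$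 be the spectral sequence of the complex $\Lambda^\bullet(\mathcal{E})$ filtered by the powers $\mathcal{C}^p\Lambda^\bullet(\mathcal{E})$ of the ideal $\mathcal{C}\Lambda^*(\mathcal{E})$, so that $E_0^{p,q}(\mathcal{E})=\mathcal{C}^p\Lambda^{p+q}(\mathcal{E})/\mathcal{C}^{p+1}\Lambda^{p+q}(\mathcal{E})$. Let $L\in\Lambda^n_h(\pi)$ be a horizontal $n$-form whose variational derivative $\mathrm{E}(L)$, given in adapted coordinates by $L=\lambda\,dx^1\wedge\dots\wedge dx^n\mapsto\sum_\alpha(-1)^{|\alpha|}D_\alpha(\partial\lambda/\partial u^i_\alpha)$, vanishes on $\mathcal{E}$. Let $\omega_L\in \mathcal{C}\Lambda^1(\pi)\wedge\pi_\infty^*\Lambda^{n-1}(M)$ be any form such that $$\mathcal{L}_{E_\varphi}L=\langle \mathrm{E}(L),\varphi\rangle+d_h(E_\varphi\lrcorner\,\omega_L)$$ for every evolutionary vector field $E_\varphi$, where $d_h$ is the horizontal differential, and let $l=(L+\omega_L)|_{\mathcal{E}}$. Then $dl\in \mathcal{C}^2\Lambda^{n+1}(\mathcal{E})$, and $dl$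 represents a $d_1$-closed element of $E_1^{2,n-1}(\mathcal{E})$ (the presymplectic structure corresponding to $L$), which in turn represents an element of $E_2^{2,n-1}(\mathcal{E})$. If this element of $E_2^{2,n-1}(\mathcal{E})$ is non-trivial, then $L|_{\mathcal{E}}\in E_0^{0,n}(\mathcal{E})$ represents a non-trivial element of $E_1^{0,n}(\mathcal{E})$, which represents a non-trivial element of $E_2^{0,n}(\mathcal{E})$. -/

import Mathlib

open scoped Manifold ContDiff Bundle

/-! ## Differential forms over a commutative algebra of functions

For the algebra `A` of smooth functions (of finite order) on a jet space, vector fields are the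
derivations of `A`, and a differential `k`-form is a finite sum of forms `f dg₁ ∧ … ∧ dg_k` with
`f, g₁, …, g_k` in `A`, evaluated on `k` vector fields. -/

namespace DiffCalc

section Algebra

variable {A : Type*} [CommRing A] [Algebra ℝ A]

/-- `A`-valued functions of `k` vector fields; the differential forms are those in `Forms A k`. -/
abbrev Cochain (A : Type*) [CommRing A] [Algebra ℝ A] (k : ℕ) : Type _ :=
  (Fin k → Derivation ℝ A A) → A

/-- The interior product `X ⌟ θ`. -/
def contract {k : ℕ} (X : Derivation ℝ A A) (θ : Cochain A (k + 1)) : Cochain A k :=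
  fun Y => θ (Fin.cons X Y)

/-- The Lie derivative along `X`. -/
def lieDer {k : ℕ} (X : Derivation ℝ A A) (θ : Cochain A k) : Cochain A k :=
  fun Y => X (θ Y) - ∑ i, θ (Function.update Y i ⁅X, Y i⁆)

/-- The de Rham differential: `X₀ ⌟ dθ = 𝓛_{X₀} θ - d (X₀ ⌟ θ)` (unfolding this recursion gives the
usual formula with the Lie brackets); on forms, `d (f dg₁ ∧ … ∧ dg_k) = df ∧ dg₁ ∧ … ∧ dg_k`,
see `extD_smul_wedgeD`. -/
def extD : (k : ℕ) → Cochain A k → Cochain A (k + 1)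
  | 0, θ => fun X => X 0 (θ (Fin.tail X))
  | k + 1, θ => fun X =>
      lieDer (X 0) θ (Fin.tail X) - extD k (contract (X 0) θ) (Fin.tail X)

/-- The form `dg₁ ∧ … ∧ dg_k`. -/
def wedgeD {k : ℕ} (g : Fin k → A) : Cochain A k :=
  fun X => Matrix.det (Matrix.of fun i j => X i (g j))

theorem extD_add (k : ℕ) (θ η : Cochain A k) : extD k (θ + η) = extD k θ + extD k η := by
  induction k with
  | zero => funext X; simp [extD]
  | succ k ih =>
    funext X
    have h : contract (X 0) (θ + η) = contract (X 0) θ + contract (X 0) η := rfl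
    simp only [extD, h, ih, lieDer, Pi.add_apply, map_add, Finset.sum_add_distrib]
    ring

theorem extD_smul (k : ℕ) (c : ℝ) (θ : Cochain A k) : extD k (c • θ) = c • extD k θ := by
  induction k with
  | zero => funext X; simp [extD]
  | succ k ih =>
    funext X
    have h : contract (X 0) (c • θ) = c • contract (X 0) θ := rfl
    simp only [extD, h, ih, lieDer, Pi.smul_apply, Derivation.map_smul, smul_sub,
      Finset.smul_sum]

theorem deriv_prod {ι : Type*} [DecidableEq ι] (X : Derivation ℝ A A) (s : Finset ι)
    (f : ι → A) :
    X (∏ i ∈ s, f i) = ∑ j ∈ s, X (f j) * ∏ i ∈ s.erase j, f i := by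
  induction s using Finset.induction_on with
  | empty => simp
  | insert a s ha ih =>
    rw [Finset.prod_insert ha, Derivation.leibniz, Finset.sum_insert ha,
      Finset.erase_insert ha, ih, smul_eq_mul, smul_eq_mul, Finset.mul_sum, add_comm]
    congr 1
    · ring
    · refine Finset.sum_congr rfl fun j hj => ?_
      have hja : a ≠ j := fun h => ha (h ▸ hj)
      rw [Finset.erase_insert_of_ne hja, Finset.prod_insert (by simp [ha])]
      ring

theorem deriv_det {k : ℕ} (X : Derivation ℝ A A) (M : Matrix (Fin (k + 1)) (Fin (k + 1)) A) :
    X M.det = ∑ j : Fin (k + 1), ∑ i : Fin (k + 1), (-1) ^ (i + j : ℕ) * X (M i j) *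
      (M.submatrix i.succAbove j.succAbove).det := by
  have h : X M.det = ∑ j, (M.updateCol j fun i => X (M i j)).det := by
    rw [Matrix.det_apply, map_sum]
    simp_rw [Matrix.det_apply]
    rw [Finset.sum_comm]
    refine Finset.sum_congr rfl fun σ _ => ?_
    rw [← Finset.smul_sum]
    rw [show X (Equiv.Perm.sign σ • ∏ i, M (σ i) i) = Equiv.Perm.sign σ • X (∏ i, M (σ i) i) by
      rcases Int.units_eq_one_or (Equiv.Perm.sign σ) with h | h <;> simp [h]]
    congr 1
    rw [deriv_prod]
    refine Finset.sum_congr rfl fun j _ => ?_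
    rw [← Finset.mul_prod_erase _ _ (Finset.mem_univ j)]
    congr 1
    · simp
    · refine Finset.prod_congr rfl fun i hi => ?_
      rw [Matrix.updateCol_ne (Finset.ne_of_mem_erase hi)]
  rw [h]
  refine Finset.sum_congr rfl fun j _ => ?_
  rw [Matrix.det_succ_column _ j]
  refine Finset.sum_congr rfl fun i _ => ?_
  simp

theorem wedgeD_cons_apply {k : ℕ} (f : A) (g : Fin k → A) (X : Fin (k + 1) → Derivation ℝ A A) :
    wedgeD (Fin.cons f g : Fin (k + 1) → A) X =
      ∑ i : Fin (k + 1), (-1) ^ (i : ℕ) * X i f * wedgeD g (fun a => X (i.succAbove a)) := by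
  rw [wedgeD, Matrix.det_succ_column_zero]
  refine Finset.sum_congr rfl fun i _ => ?_
  simp [wedgeD, Matrix.submatrix]

theorem contract_wedgeD {k : ℕ} (f : A) (g : Fin (k + 1) → A) (X : Derivation ℝ A A) :
    contract X (f • wedgeD g) =
      ∑ j : Fin (k + 1), ((-1) ^ (j : ℕ) * f * X (g j)) • wedgeD (fun a => g (j.succAbove a)) := by
  funext Y
  simp only [contract, Pi.smul_apply, wedgeD, smul_eq_mul, Finset.sum_apply]
  rw [Matrix.det_succ_row_zero, Finset.mul_sum]
  refine Finset.sum_congr rfl fun j _ => ?_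
  simp [Matrix.submatrix]
  ring

theorem extD_sum (k : ℕ) {ι : Type*} (s : Finset ι) (θ : ι → Cochain A k) :
    extD k (∑ i ∈ s, θ i) = ∑ i ∈ s, extD k (θ i) := by
  classical
  induction s using Finset.induction_on with
  | empty => simpa using extD_smul k 0 (0 : Cochain A k)
  | insert a s ha ih => rw [Finset.sum_insert ha, Finset.sum_insert ha, extD_add, ih]

theorem lieDer_wedgeD {k : ℕ} (f : A) (g : Fin (k + 1) → A) (X : Derivation ℝ A A)
    (Y : Fin (k + 1) → Derivation ℝ A A) :
    lieDer X (f • wedgeD g) Y = X f * wedgeD g Y +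
      f * ∑ j : Fin (k + 1), (-1) ^ (j : ℕ) *
        wedgeD (Fin.cons (X (g j)) fun a => g (j.succAbove a) : Fin (k + 1) → A) Y := by
  have h1 : ∀ i, wedgeD g (Function.update Y i ⁅X, Y i⁆) = ∑ j : Fin (k + 1),
      (-1) ^ (i + j : ℕ) * (⁅X, Y i⁆ (g j)) *
        wedgeD (fun a => g (j.succAbove a)) (fun a => Y (i.succAbove a)) := by
    intro i
    rw [wedgeD, Matrix.det_succ_row _ i]
    refine Finset.sum_congr rfl fun j _ => ?_
    simp [wedgeD, Matrix.submatrix]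
  simp only [lieDer, Pi.smul_apply, smul_eq_mul, Derivation.leibniz, h1, ← Finset.mul_sum]
  conv_lhs => rw [show wedgeD g Y = (Matrix.of fun i j => Y i (g j)).det from rfl]
  rw [deriv_det, Finset.sum_comm]
  have h2 : ∀ j : Fin (k + 1), (-1) ^ (j : ℕ) *
        wedgeD (Fin.cons (X (g j)) fun a => g (j.succAbove a) : Fin (k + 1) → A) Y =
      ∑ i : Fin (k + 1), (-1) ^ (i + j : ℕ) * (Y i (X (g j))) *
        wedgeD (fun a => g (j.succAbove a)) (fun a => Y (i.succAbove a)) := by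
    intro j
    rw [wedgeD_cons_apply, Finset.mul_sum]
    refine Finset.sum_congr rfl fun i _ => ?_
    rw [pow_add]; ring
  simp only [h2]
  rw [Finset.sum_comm (s := Finset.univ) (t := Finset.univ)
    (f := fun (j i : Fin (k + 1)) => (-1) ^ (i + j : ℕ) * (Y i (X (g j))) *
        wedgeD (fun a => g (j.succAbove a)) (fun a => Y (i.succAbove a)))]
  rw [add_sub_right_comm, ← mul_sub, ← Finset.sum_sub_distrib, add_comm]
  congr 1
  · rw [mul_comm]; rfl
  · congr 1
    refine Finset.sum_congr rfl fun i _ => ?_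
    rw [← Finset.sum_sub_distrib]
    refine Finset.sum_congr rfl fun j _ => ?_
    simp only [Derivation.commutator_apply, Matrix.of_apply, wedgeD, Matrix.submatrix]
    ring

theorem wedgeD_cons_mul {k : ℕ} (j : ℕ) (f c : A) (g : Fin k → A)
    (X : Fin (k + 1) → Derivation ℝ A A) :
    wedgeD (Fin.cons ((-1) ^ j * f * c) g : Fin (k + 1) → A) X =
      (-1) ^ j * (f * wedgeD (Fin.cons c g : Fin (k + 1) → A) X +
        c * wedgeD (Fin.cons f g : Fin (k + 1) → A) X) := by
  simp only [wedgeD_cons_apply, Finset.mul_sum, ← Finset.sum_add_distrib]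
  refine Finset.sum_congr rfl fun i _ => ?_
  have h : X i ((-1) ^ j) = 0 := by
    rcases neg_one_pow_eq_or A j with h | h <;> simp [h]
  simp only [Derivation.leibniz, smul_eq_mul, h]
  ring

theorem extD_smul_wedgeD (k : ℕ) (f : A) (g : Fin k → A) :
    extD k (f • wedgeD g) = wedgeD (Fin.cons f g : Fin (k + 1) → A) := by
  induction k generalizing f with
  | zero => funext X; simp [extD, wedgeD]
  | succ k ih =>
    funext X
    have h := congrFun (contract_wedgeD 1 (Fin.cons f g : Fin (k + 2) → A) (X 0)) (Fin.tail X)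
    rw [one_smul, contract, Fin.cons_self_tail] at h
    rw [h]
    change lieDer (X 0) (f • wedgeD g) (Fin.tail X) -
      extD k (contract (X 0) (f • wedgeD g)) (Fin.tail X) = _
    rw [lieDer_wedgeD, contract_wedgeD, extD_sum]
    simp only [ih, Finset.sum_apply, wedgeD_cons_mul, Fin.sum_univ_succ (n := k + 1)]
    have h0 : ∀ j : Fin (k + 1), (fun a => (Fin.cons f g : Fin (k + 2) → A) (j.succ.succAbove a)) =
        (Fin.cons f fun a => g (j.succAbove a) : Fin (k + 1) → A) := by
      intro j
      funext a
      refine Fin.cases ?_ (fun a => ?_) a <;> simp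
    simp only [h0, Pi.smul_apply, smul_eq_mul, Finset.mul_sum, Fin.cons_succ, Fin.succAbove_zero,
      Fin.cons_zero, Fin.val_zero, pow_zero, Fin.val_succ, one_mul, mul_one]
    rw [add_sub_assoc, ← Finset.sum_sub_distrib]
    congr 1
    refine Finset.sum_congr rfl fun j _ => ?_
    ring

/-- `d (X ⌟ θ)`, which has the same degree as `θ` (it is zero in degree zero). -/
def extDContract (X : Derivation ℝ A A) : {k : ℕ} → Cochain A k → Cochain A k
  | 0, _ => 0
  | k + 1, θ => extD k (contract X θ)

/-- The module `Λᵏ` of differential `k`-forms. -/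
def Forms (A : Type*) [CommRing A] [Algebra ℝ A] (k : ℕ) : Submodule A (Cochain A k) :=
  Submodule.span A (Set.range wedgeD)

/-- `I · Λᵏ + dI ∧ Λᵏ⁻¹`, the degree `k` part of the ideal generated by `I` and `dI`. -/
def idealForms (I : Ideal A) (k : ℕ) : Submodule A (Cochain A k) :=
  Submodule.span A ({θ | ∃ f ∈ I, ∃ g : Fin k → A, θ = f • wedgeD g} ∪
    {θ | ∃ g : Fin k → A, (∃ j, g j ∈ I) ∧ θ = wedgeD g})

theorem extD_mem_forms {k : ℕ} {θ : Cochain A k} (h : θ ∈ Forms A k) :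
    extD k θ ∈ Forms A (k + 1) := by
  refine Submodule.closure_induction (p := fun θ _ => extD k θ ∈ Forms A (k + 1)) ?_ ?_ ?_ h
  · have := extD_smul k 0 (0 : Cochain A k)
    simp only [zero_smul] at this
    rw [this]; exact Submodule.zero_mem _
  · intro x y _ _ hx hy
    rw [extD_add]; exact Submodule.add_mem _ hx hy
  · rintro r x ⟨g, rfl⟩
    rw [extD_smul_wedgeD]; exact Submodule.subset_span ⟨_, rfl⟩

theorem extD_extD {k : ℕ} {θ : Cochain A k} (h : θ ∈ Forms A k) :
    extD (k + 1) (extD k θ) = 0 := by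
  have h0 : ∀ k, extD k (0 : Cochain A k) = 0 := fun k => by
    simpa using extD_smul k 0 (0 : Cochain A k)
  refine Submodule.closure_induction (p := fun θ _ => extD (k + 1) (extD k θ) = 0) ?_ ?_ ?_ h
  · rw [h0, h0]
  · intro x y _ _ hx hy
    rw [extD_add, extD_add, hx, hy, add_zero]
  · rintro r x ⟨g, rfl⟩
    rw [extD_smul_wedgeD, ← one_smul A (wedgeD _), extD_smul_wedgeD]
    funext X
    rw [wedgeD_cons_apply]
    simp

theorem extD_mem_idealForms (I : Ideal A) {k : ℕ} {θ : Cochain A k} (h : θ ∈ idealForms I k) :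
    extD k θ ∈ idealForms I (k + 1) := by
  refine Submodule.closure_induction (p := fun θ _ => extD k θ ∈ idealForms I (k + 1)) ?_ ?_ ?_ h
  · have := extD_smul k 0 (0 : Cochain A k)
    simp only [zero_smul] at this
    rw [this]; exact Submodule.zero_mem _
  · intro x y _ _ hx hy
    rw [extD_add]; exact Submodule.add_mem _ hx hy
  · rintro r x (⟨f, hf, g, rfl⟩ | ⟨g, ⟨j, hj⟩, rfl⟩)
    · rw [smul_smul, extD_smul_wedgeD]
      exact Submodule.subset_span (Or.inr ⟨_, ⟨0, by simpa using I.mul_mem_left r hf⟩, rfl⟩)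
    · rw [extD_smul_wedgeD]
      exact Submodule.subset_span (Or.inr ⟨_, ⟨j.succ, by simpa using hj⟩, rfl⟩)

/-- The de Rham differential `Λᵏ → Λᵏ⁺¹`. -/
def dForms (k : ℕ) : Forms A k →ₗ[ℝ] Forms A (k + 1) where
  toFun θ := ⟨extD k θ.1, extD_mem_forms θ.2⟩
  map_add' θ η := Subtype.ext (extD_add k θ.1 η.1)
  map_smul' c θ := Subtype.ext (extD_smul k c θ.1)

/-- The forms that are zero on the subset with vanishing ideal `I`. -/
def relForms (I : Ideal A) (k : ℕ) : Submodule ℝ (Forms A k) :=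
  ((idealForms I k).comap (Forms A k).subtype).restrictScalars ℝ

/-- The module `Λᵏ(𝓔)` of differential forms on the subset `𝓔` with vanishing ideal `I`: the degree
`k` part of the quotient of `Λ*` by the ideal generated by `I` and `dI`. This is the exterior
algebra of `Λ¹ / (I · Λ¹ + A · dI)` over `A / I`. -/
def FormsOn (I : Ideal A) (k : ℕ) : Type _ := Forms A k ⧸ relForms I k

instance (I : Ideal A) (k : ℕ) : AddCommGroup (FormsOn I k) :=
  inferInstanceAs (AddCommGroup (Forms A k ⧸ relForms I k))

instance (I : Ideal A) (k : ℕ) : Module ℝ (FormsOn I k) :=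
  inferInstanceAs (Module ℝ (Forms A k ⧸ relForms I k))

/-- Restriction of forms to the subset with vanishing ideal `I`. -/
def restrictForm (I : Ideal A) (k : ℕ) : Forms A k →ₗ[ℝ] FormsOn I k := (relForms I k).mkQ

/-- The de Rham differential `Λᵏ(𝓔) → Λᵏ⁺¹(𝓔)`. -/
def dOn (I : Ideal A) (k : ℕ) : FormsOn I k →ₗ[ℝ] FormsOn I (k + 1) :=
  Submodule.mapQ _ _ (dForms k) fun _ hθ => extD_mem_idealForms I hθ

theorem dOn_dOn (I : Ideal A) (k : ℕ) (θ : FormsOn I k) : dOn I (k + 1) (dOn I k θ) = 0 := by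
  obtain ⟨θ, rfl⟩ := Submodule.Quotient.mk_surjective _ θ
  change Submodule.Quotient.mk (dForms (k + 1) (dForms k θ)) = _
  rw [show dForms (k + 1) (dForms k θ) = 0 from Subtype.ext (extD_extD θ.2)]
  rfl

end Algebra

/-! ## The spectral sequence of a filtered complex

`C` is a cochain complex with differential `d`, and `F p k` is the `p`-th step of a decreasing
filtration in degree `k`. The index `k` is the total degree: `Page d F r p k` is the group
usually written `E_r^{p, q}` with `q = k - p`. The filtration is understood to be everything for
`p ≤ 0`, which is why `p + 1 - r` may be read in the natural numbers. -/

section SpectralSequence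

variable {C : ℕ → Type*} [∀ k, AddCommGroup (C k)] [∀ k, Module ℝ (C k)]
  (d : ∀ k, C k →ₗ[ℝ] C (k + 1)) (F : ℕ → ∀ k, Submodule ℝ (C k))

/-- `Z_r^p = {z ∈ F^p | dz ∈ F^{p + r}}`. -/
def cyc (r p k : ℕ) : Submodule ℝ (C k) := F p k ⊓ (F (p + r) (k + 1)).comap (d k)

/-- `B_r^p = {z ∈ F^{p + 1} | dz ∈ F^{p + r}} + (F^p ∩ d F^{p + 1 - r})`. -/
def bnd (r p : ℕ) : ∀ k, Submodule ℝ (C k)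
  | 0 => F (p + 1) 0 ⊓ (F (p + r) 1).comap (d 0)
  | k + 1 => (F (p + 1) (k + 1) ⊓ (F (p + r) (k + 2)).comap (d (k + 1))) ⊔
      (F p (k + 1) ⊓ (F (p + 1 - r) k).map (d k))

/-- `E_r^{p, q} = Z_r^p / B_r^p` in total degree `k = p + q`. In particular `E_0` is the graded
object of the filtration, and `E_{r + 1}` is the cohomology of `d_r` on `E_r`. -/
abbrev Page (r p k : ℕ) : Type _ := cyc d F r p k ⧸ (bnd d F r p k).submoduleOf (cyc d F r p k)

/-- `x` is the element of `E_r^{p, q}` that `z` gives rise to. -/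
def IsClassOf {r p k : ℕ} (z : C k) (x : Page d F r p k) : Prop :=
  ∃ h : z ∈ cyc d F r p k, x = Submodule.Quotient.mk ⟨z, h⟩

/-- The element `x` of `E_r^{p, q}` represents the element `y` of `E_{r + 1}^{p, q}`, that is,
`x` is in the kernel of `d_r` and `y` is its cohomology class. -/
def Represents {r p k : ℕ} (x : Page d F r p k) (y : Page d F (r + 1) p k) : Prop :=
  ∃ z : C k, IsClassOf d F z x ∧ IsClassOf d F z y

/-- The differential `d_r : E_r^{p, q} → E_r^{p + r, q + 1 - r}`, induced by `d`. -/
def pageD (hd : ∀ k z, d (k + 1) (d k z) = 0) (r p k : ℕ) :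
    Page d F r p k →ₗ[ℝ] Page d F r (p + r) (k + 1) :=
  Submodule.mapQ _ _
    ((d k).restrict (p := cyc d F r p k) (q := cyc d F r (p + r) (k + 1)) fun z hz =>
      ⟨hz.2, by simp [hd]⟩) <| by
    rintro ⟨z, hz⟩ hb
    change d k z ∈ bnd d F r (p + r) (k + 1)
    have key : ∀ c ∈ F (p + 1) k, d k c ∈ F (p + r) (k + 1) →
        d k c ∈ bnd d F r (p + r) (k + 1) := fun c hc hdc =>
      Submodule.mem_sup_right ⟨hdc, c, by rwa [show p + r + 1 - r = p + 1 by omega], rfl⟩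
    cases k with
    | zero => exact key z hb.1 hb.2
    | succ k =>
      obtain ⟨c, hc, _, ⟨_, e, _, rfl⟩, h⟩ :=
        Submodule.mem_sup.1 (show z ∈ bnd d F r p (k + 1) from hb)
      rw [← h, map_add, hd, add_zero]
      exact key c hc.1 hc.2

end SpectralSequence

end DiffCalc

/-! ## Jets -/

namespace JetGeom

open DiffCalc

section Coordinates

/-- The space with coordinates `xʲ` and `uⁱ_α`, where `α` is a multi-index. -/
abbrev JetCoords (n m : ℕ) : Type := EuclideanSpace ℝ (Fin n) × (Fin m → (Fin n → ℕ) → ℝ)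

/-- `T₁^{α₁} ∘ … ∘ T_n^{α_n}`. -/
def iterOps {β : Type*} {n : ℕ} (T : Fin n → β → β) (α : Fin n → ℕ) (b : β) : β :=
  (List.ofFn fun j => (T j)^[α j]).foldr (fun S c => S c) b

/-- `∂h / ∂xʲ`. -/
noncomputable def basePartial {n : ℕ} (j : Fin n) (h : EuclideanSpace ℝ (Fin n) → ℝ) :
    EuclideanSpace ℝ (Fin n) → ℝ :=
  fun y => lineDeriv ℝ h y (EuclideanSpace.single j 1)

/-- `∂G / ∂uⁱ_α`. -/
noncomputable def fibrePartial {n m : ℕ} (i : Fin m) (α : Fin n → ℕ) (G : JetCoords n m → ℝ) :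
    JetCoords n m → ℝ :=
  fun p => lineDeriv ℝ G p (0, Pi.single i (Pi.single α 1))

/-- The total derivative `D_{xʲ} = ∂_{xʲ} + ∑ uⁱ_{α + xʲ} ∂_{uⁱ_α}`. -/
noncomputable def totalD {n m : ℕ} (j : Fin n) (G : JetCoords n m → ℝ) : JetCoords n m → ℝ :=
  fun p => lineDeriv ℝ G p (EuclideanSpace.single j 1, 0) +
    ∑ᶠ a : Fin m × (Fin n → ℕ), p.2 a.1 (a.2 + Pi.single j 1) * fibrePartial a.1 a.2 G p

/-- `δG / δuⁱ = ∑_α (-1)^{|α|} D_α (∂G / ∂uⁱ_α)`. -/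
noncomputable def varDeriv {n m : ℕ} (i : Fin m) (G : JetCoords n m → ℝ) : JetCoords n m → ℝ :=
  fun p => ∑ᶠ α : Fin n → ℕ, (-1) ^ (∑ j, α j) * iterOps totalD α (fibrePartial i α G) p

/-- The multi-indices of length at most `k`. -/
def multiIdx (n k : ℕ) : Finset (Fin n → ℕ) :=
  (Fintype.piFinset fun _ => Finset.range (k + 1)).filter fun α => ∑ j, α j ≤ k

/-- `G` is, over `U`, a smooth function of the `xʲ` and of the `uⁱ_α` with `|α| ≤ k`. -/
def SmoothOfOrder {n m : ℕ} (k : ℕ) (U : Set (EuclideanSpace ℝ (Fin n)))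
    (G : JetCoords n m → ℝ) : Prop :=
  ∃ g : EuclideanSpace ℝ (Fin n) × (Fin m → multiIdx n k → ℝ) → ℝ,
    ContDiffOn ℝ ∞ g (U ×ˢ Set.univ) ∧ ∀ p, p.1 ∈ U → G p = g (p.1, fun i α => p.2 i α)

theorem multiIdx_mono {n k k' : ℕ} (h : k ≤ k') : multiIdx n k ⊆ multiIdx n k' := by
  intro α hα
  simp only [multiIdx, Finset.mem_filter, Fintype.mem_piFinset, Finset.mem_range] at hα ⊢
  exact ⟨fun i => by have := hα.1 i; omega, hα.2.trans h⟩

theorem SmoothOfOrder.mono {n m k k' : ℕ} {U : Set (EuclideanSpace ℝ (Fin n))}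
    {G : JetCoords n m → ℝ} (hG : SmoothOfOrder k U G) (h : k ≤ k') : SmoothOfOrder k' U G := by
  obtain ⟨g, hg, hGg⟩ := hG
  refine ⟨fun p => g (p.1, fun i α => p.2 i ⟨α, multiIdx_mono h α.2⟩), ?_, hGg⟩
  refine hg.comp (t := U ×ˢ Set.univ) (ContDiff.contDiffOn ?_) fun p hp => ⟨hp.1, trivial⟩
  fun_prop

end Coordinates

section Bundle

variable (n m : ℕ) {M : Type*} [TopologicalSpace M] [ChartedSpace (EuclideanSpace ℝ (Fin n)) M]
  (V : M → Type*) [TopologicalSpace (Bundle.TotalSpace (Fin m → ℝ) V)]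
  [∀ x, TopologicalSpace (V x)] [∀ x, AddCommGroup (V x)] [∀ x, Module ℝ (V x)]
  [FiberBundle (Fin m → ℝ) V]

/-- The domain of the adapted coordinates around `x₀`. -/
def adaptedDom (x₀ : M) : Set M :=
  (chartAt (EuclideanSpace ℝ (Fin n)) x₀).source ∩ (trivializationAt (Fin m → ℝ) V x₀).baseSet

/-- The value at `x` of `uⁱ_α` for the section `s`, in the adapted coordinates around `x₀`: the
partial derivative with multi-index `α` of the `i`-th component of `s`. -/
noncomputable def jetCoord (x₀ : M) (s : ∀ x, V x) (x : M) (i : Fin m) (α : Fin n → ℕ) : ℝ :=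
  iterOps basePartial α
    (fun y => (trivializationAt (Fin m → ℝ) V x₀
      ⟨(chartAt (EuclideanSpace ℝ (Fin n)) x₀).symm y,
        s ((chartAt (EuclideanSpace ℝ (Fin n)) x₀).symm y)⟩).2 i)
    (chartAt (EuclideanSpace ℝ (Fin n)) x₀ x)

variable [VectorBundle ℝ (Fin m → ℝ) V]

/-- Smooth sections of the bundle. -/
abbrev Sec : Type _ := ContMDiffSection (𝓡 n) (Fin m → ℝ) ∞ V

/-- Two pairs of a point and a section have the same infinite jet if the points are the same and
all partial derivatives there are the same in adapted coordinates. -/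
def jetSetoid : Setoid (M × Sec n m V) where
  r a b := a.1 = b.1 ∧ ∀ x₀, a.1 ∈ adaptedDom n m V x₀ → ∀ i α,
    jetCoord n m V x₀ a.2 a.1 i α = jetCoord n m V x₀ b.2 b.1 i α
  iseqv :=
    { refl := fun _ => ⟨rfl, fun _ _ _ _ => rfl⟩
      symm := fun {_ _} h => ⟨h.1.symm, fun x₀ hx i α => (h.2 x₀ (h.1 ▸ hx) i α).symm⟩
      trans := fun {_ _ _} h h' => ⟨h.1.trans h'.1, fun x₀ hx i α =>
        (h.2 x₀ hx i α).trans (h'.2 x₀ (h.1 ▸ hx) i α)⟩ }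

/-- The infinite jet space `J^∞(π)`. (Every jet of a local section is the jet of a global one.) -/
def Jet : Type _ := Quotient (jetSetoid n m V)

variable {n m V}

/-- The infinite jet of the section `σ` at `x`. -/
def jet (x : M) (σ : Sec n m V) : Jet n m V := Quotient.mk (jetSetoid n m V) (x, σ)

/-- The projection `π_∞ : J^∞(π) → M`. -/
def Jet.base (ρ : Jet n m V) : M :=
  Quotient.lift (s := jetSetoid n m V) (fun a => a.1) (fun _ _ h => And.left h) ρ

open scoped Classical in
/-- The adapted coordinates around `x₀` on the infinite jet space (zero outside their domain). -/
noncomputable def Jet.coords (x₀ : M) (ρ : Jet n m V) : JetCoords n m :=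
  Quotient.lift
    (fun a : M × Sec n m V => if a.1 ∈ adaptedDom n m V x₀ then
      ((chartAt (EuclideanSpace ℝ (Fin n)) x₀ a.1, jetCoord n m V x₀ a.2 a.1) : JetCoords n m)
      else 0)
    (by
      rintro ⟨x, σ⟩ ⟨y, τ⟩ ⟨h, h'⟩
      obtain rfl : x = y := h
      by_cases hx : x ∈ adaptedDom n m V x₀
      · simp only [hx, if_true]
        exact Prod.ext rfl (funext fun i => funext fun α => h' x₀ hx i α)
      · simp only [hx, if_false]) ρ

/-- Over the subset `U` of the domain of the adapted coordinates around `x₀`, the function `f` is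
the smooth function `G` of these coordinates, of order at most `k`. -/
def LocalRep (k : ℕ) (x₀ : M) (U : Set M) (f : Jet n m V → ℝ) (G : JetCoords n m → ℝ) : Prop :=
  SmoothOfOrder k (chartAt (EuclideanSpace ℝ (Fin n)) x₀ '' U) G ∧
    ∀ ρ : Jet n m V, ρ.base ∈ U → f ρ = G (ρ.coords x₀)

variable (n m V)

/-- The algebra `𝓕(π)` of smooth functions on `J^∞(π)`; each is of some finite order. -/
def JetFun : Subalgebra ℝ (Jet n m V → ℝ) where
  carrier := {f | ∃ k, ∀ x₀, ∃ G, LocalRep k x₀ (adaptedDom n m V x₀) f G}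
  mul_mem' := by
    rintro f f' ⟨k, h⟩ ⟨k', h'⟩
    refine ⟨max k k', fun x₀ => ?_⟩
    obtain ⟨G, hG, hf⟩ := h x₀
    obtain ⟨G', hG', hf'⟩ := h' x₀
    obtain ⟨g, hg, e⟩ := hG.mono (le_max_left k k')
    obtain ⟨g', hg', e'⟩ := hG'.mono (le_max_right k k')
    exact ⟨G * G', ⟨g * g', hg.mul hg', fun p hp => by simp [e p hp, e' p hp]⟩,
      fun ρ hρ => by simp [hf ρ hρ, hf' ρ hρ]⟩
  add_mem' := by
    rintro f f' ⟨k, h⟩ ⟨k', h'⟩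
    refine ⟨max k k', fun x₀ => ?_⟩
    obtain ⟨G, hG, hf⟩ := h x₀
    obtain ⟨G', hG', hf'⟩ := h' x₀
    obtain ⟨g, hg, e⟩ := hG.mono (le_max_left k k')
    obtain ⟨g', hg', e'⟩ := hG'.mono (le_max_right k k')
    exact ⟨G + G', ⟨g + g', hg.add hg', fun p hp => by simp [e p hp, e' p hp]⟩,
      fun ρ hρ => by simp [hf ρ hρ, hf' ρ hρ]⟩
  algebraMap_mem' c :=
    ⟨0, fun _ => ⟨fun _ => c, ⟨fun _ => c, contDiffOn_const, fun _ _ => rfl⟩, fun _ _ => rfl⟩⟩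

/-- Vector fields on `J^∞(π)`. -/
abbrev JetField : Type _ := Derivation ℝ (JetFun n m V) (JetFun n m V)

/-- Differential `k`-forms on `J^∞(π)`. -/
abbrev JetForms (k : ℕ) : Type _ := Forms (JetFun n m V) k

/-- Smooth sections, of finite order, of the pullback to `J^∞(π)` of a vector bundle `W` of rank
`l` over `M`; equivalently, nonlinear differential operators from sections of `V` to sections
of `W`. For `W = V` these are the elements of `ϰ(π)`. -/
structure JetSection (l : ℕ) (W : M → Type*) [TopologicalSpace (Bundle.TotalSpace (Fin l → ℝ) W)]
    [∀ x, TopologicalSpace (W x)] [FiberBundle (Fin l → ℝ) W] where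
  /-- the value at a jet -/
  val : ∀ ρ : Jet n m V, W ρ.base
  smooth : ∃ k, ∀ x₀ i, ∃ G, LocalRep k x₀
    (adaptedDom n m V x₀ ∩ (trivializationAt (Fin l → ℝ) W x₀).baseSet)
    (fun ρ => (trivializationAt (Fin l → ℝ) W x₀ ⟨ρ.base, val ρ⟩).2 i) G

variable {n m V}

/-- The infinite prolongation of the equation `F = 0`: the set of the infinite jets at which all
`D_α (Fⁱ)` are zero, in adapted coordinates. -/
def prolongation {l : ℕ} {W : M → Type*} [TopologicalSpace (Bundle.TotalSpace (Fin l → ℝ) W)]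
    [∀ x, TopologicalSpace (W x)] [FiberBundle (Fin l → ℝ) W] (F : JetSection n m V l W) :
    Set (Jet n m V) :=
  {ρ | ∀ x₀, ρ.base ∈ adaptedDom n m V x₀ ∩ (trivializationAt (Fin l → ℝ) W x₀).baseSet →
    ∀ i k G, LocalRep k x₀ (adaptedDom n m V x₀ ∩ (trivializationAt (Fin l → ℝ) W x₀).baseSet)
      (fun ρ => (trivializationAt (Fin l → ℝ) W x₀ ⟨ρ.base, F.val ρ⟩).2 i) G →
    ∀ α, iterOps totalD α G (ρ.coords x₀) = 0}

/-- The ideal of the functions that vanish on `S`. -/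
def vanishingIdeal (S : Set (Jet n m V)) : Ideal (JetFun n m V) where
  carrier := {f | ∀ ρ ∈ S, f.1 ρ = 0}
  add_mem' hf hg ρ hρ := by simp [hf ρ hρ, hg ρ hρ]
  zero_mem' _ _ := rfl
  smul_mem' c f hf ρ hρ := by simp [hf ρ hρ]

/-! ### The Cartan distribution -/

/-- The value of `X` at `ρ` is the vector of the Cartan plane that projects to the vector `v` of
`M`, i.e. the image of `v` under the differential of the jet prolongation of a section. -/
def IsLiftAt (X : JetField n m V) (ρ : Jet n m V) (v : TangentSpace (𝓡 n) ρ.base) : Prop :=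
  ∀ (x : M) (σ : Sec n m V), jet x σ = ρ → ∀ f : JetFun n m V,
    (X f).1 ρ = mfderiv (𝓡 n) 𝓘(ℝ, ℝ) (fun y => f.1 (jet y σ)) ρ.base v

/-- The value of `X` at `ρ` lies in the Cartan plane. -/
def IsCartanAt (X : JetField n m V) (ρ : Jet n m V) : Prop := ∃ v, IsLiftAt X ρ v

/-- The value of `X` at `ρ` is tangent to the fibre of `π_∞`. -/
def IsVerticalAt (X : JetField n m V) (ρ : Jet n m V) : Prop :=
  ∀ f : JetFun n m V, (∀ ρ₁ ρ₂ : Jet n m V, ρ₁.base = ρ₂.base → f.1 ρ₁ = f.1 ρ₂) → (X f).1 ρ = 0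

/-- The value at `ρ` of the `k`-form `θ` lies in the `p`-th power of the ideal generated by Cartan
`1`-forms: `θ` is zero there as soon as at least `k - p + 1` of its arguments are in the Cartan
plane. -/
def InCartanPowAt (p : ℕ) {k : ℕ} (θ : Cochain (JetFun n m V) k) (ρ : Jet n m V) : Prop :=
  ∀ (X : Fin k → JetField n m V) (s : Finset (Fin k)), k + 1 ≤ s.card + p →
    (∀ i ∈ s, IsCartanAt (X i) ρ) → (θ X).1 ρ = 0

/-- The filtration `𝓒^pΛᵏ(𝓔)` of the forms on `𝓔` by the powers of the Cartan ideal: the forms whose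
value at each point of `𝓔` lies in the `p`-th power of the ideal. (A form on the jet space with this
property is the sum of one that has it everywhere and of one that is zero at the points of `𝓔`.) -/
def cartanFiltration (S : Set (Jet n m V)) (p k : ℕ) :
    Submodule ℝ (FormsOn (vanishingIdeal S) k) :=
  Submodule.map (restrictForm (vanishingIdeal S) k)
    { carrier := {θ | ∀ ρ ∈ S, InCartanPowAt p θ.1 ρ}
      add_mem' := fun hθ hη ρ hρ X s hs hX => by
        simp [hθ ρ hρ X s hs hX, hη ρ hρ X s hs hX]
      zero_mem' := fun _ _ _ _ _ _ => rfl
      smul_mem' := fun c θ hθ ρ hρ X s hs hX => by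
        simp [hθ ρ hρ X s hs hX] }

/-- The group `E_r^{p, q}(𝓔)` of the Vinogradov `𝓒`-spectral sequence, in total degree
`k = p + q`. -/
abbrev VinE (S : Set (Jet n m V)) (r p k : ℕ) : Type _ :=
  Page (dOn (vanishingIdeal S)) (cartanFiltration S) r p k

/-- The differential `d_r : E_r^{p, q}(𝓔) → E_r^{p + r, q + 1 - r}(𝓔)`. -/
def vinD (S : Set (Jet n m V)) (r p k : ℕ) : VinE S r p k →ₗ[ℝ] VinE S r (p + r) (k + 1) :=
  pageD _ _ (dOn_dOn (vanishingIdeal S)) r p k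

/-! ### Lagrangians -/

/-- `θ` is a horizontal form, an element of `𝓕(π) · π_∞^* Λᵏ(M)`: it is zero if one of its
arguments is vertical. -/
def IsHorizontal {k : ℕ} (θ : Cochain (JetFun n m V) k) : Prop :=
  ∀ (X : Fin k → JetField n m V) (ρ : Jet n m V), (∃ i, IsVerticalAt (X i) ρ) → (θ X).1 ρ = 0

/-- `dx¹ ∧ … ∧ dxⁿ` for the chart around `x₀`. -/
noncomputable def coordVol (x₀ : M) {x : M} (v : Fin n → TangentSpace (𝓡 n) x) : ℝ :=
  Matrix.det (Matrix.of fun a b =>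
    (show EuclideanSpace ℝ (Fin n) from
      mfderiv (𝓡 n) (𝓡 n) (chartAt (EuclideanSpace ℝ (Fin n)) x₀) x (v a)) b)

/-- `L = lam dx¹ ∧ … ∧ dxⁿ` in adapted coordinates around `x₀`. -/
def IsDensity (x₀ : M) (L : Cochain (JetFun n m V) n) (lam : JetCoords n m → ℝ) : Prop :=
  (∃ k, SmoothOfOrder k (chartAt (EuclideanSpace ℝ (Fin n)) x₀ '' adaptedDom n m V x₀) lam) ∧
    ∀ ρ : Jet n m V, ρ.base ∈ adaptedDom n m V x₀ →
      ∀ (X : Fin n → JetField n m V) (v : Fin n → TangentSpace (𝓡 n) ρ.base),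
        (∀ a, IsLiftAt (X a) ρ (v a)) → (L X).1 ρ = lam (ρ.coords x₀) * coordVol x₀ v

open scoped Classical in
/-- The density of `L` in adapted coordinates around `x₀` (it exists, and is unique over the domain
of the coordinates, for each `n`-form `L`). -/
noncomputable def density (x₀ : M) (L : Cochain (JetFun n m V) n) : JetCoords n m → ℝ :=
  if h : ∃ lam, IsDensity x₀ L lam then h.choose else 0

/-- The value at `ρ` of the variational derivative `E(L)`, an element of
`Hom(ϰ(π), Λⁿ_h(π))`: `⟨E(L), w⟩ = δlam / δuⁱ wⁱ dx¹ ∧ … ∧ dxⁿ` for `w` in the fibre of the bundle,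
evaluated on the tangent vectors `v`, in adapted coordinates around the base point of `ρ`. -/
noncomputable def eulerForm (L : Cochain (JetFun n m V) n) (ρ : Jet n m V) (w : V ρ.base)
    (v : Fin n → TangentSpace (𝓡 n) ρ.base) : ℝ :=
  (∑ i, varDeriv i (density ρ.base L) (ρ.coords ρ.base) *
    (trivializationAt (Fin m → ℝ) V ρ.base ⟨ρ.base, w⟩).2 i) * coordVol ρ.base v

/-- The variational derivative `E(L)` vanishes on `S`. -/
def EulerVanishesOn (L : Cochain (JetFun n m V) n) (S : Set (Jet n m V)) : Prop :=
  ∀ ρ ∈ S, ∀ w v, eulerForm L ρ w v = 0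

variable [ContMDiffVectorBundle ∞ (Fin m → ℝ) V (𝓡 n)]

/-- `X` is the evolutionary vector field `E_φ = D_α(φⁱ) ∂_{uⁱ_α}`: at the jet of `σ` it is the
velocity of the jets of `σ + ε τ`, where `τ` is the section `y ↦ φ(j_y σ)`. -/
def IsEvolutionary (φ : JetSection n m V m V) (X : JetField n m V) : Prop :=
  ∀ σ : Sec n m V, ∃ τ : Sec n m V, (∀ y, τ y = φ.val (jet y σ)) ∧
    ∀ (x : M) (f : JetFun n m V),
      (X f).1 (jet x σ) = deriv (fun ε : ℝ => f.1 (jet x (σ + ε • τ))) 0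

/-- `θ` is a form as in the Noether formula for `L`: it lies in
`𝓒Λ¹(π) ∧ π_∞^* Λⁿ⁻¹(M)` (it is zero if all its arguments are in the Cartan plane, or if two of
them are vertical), and, for each `φ` in `ϰ(π)`,
`𝓛_{E_φ} L = ⟨E(L), φ⟩ + d_h (E_φ ⌟ θ)` as horizontal forms, i.e. on arguments in the Cartan
distribution. -/
def IsNoetherForm (L θ : Cochain (JetFun n m V) n) : Prop :=
  (∀ ρ, InCartanPowAt 1 θ ρ) ∧
  (∀ (X : Fin n → JetField n m V) (ρ : Jet n m V),
    (∃ a b, a ≠ b ∧ IsVerticalAt (X a) ρ ∧ IsVerticalAt (X b) ρ) → (θ X).1 ρ = 0) ∧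
  ∀ (φ : JetSection n m V m V) (X : JetField n m V), IsEvolutionary φ X →
    ∀ (ρ : Jet n m V) (Y : Fin n → JetField n m V) (v : Fin n → TangentSpace (𝓡 n) ρ.base),
      (∀ a, IsLiftAt (Y a) ρ (v a)) →
        (lieDer X L Y).1 ρ = eulerForm L ρ (φ.val ρ) v + (extDContract X θ Y).1 ρ

/-- The presymplectic structure determined by `L` and `θ`: the element `Ω` of
`E_1^{2, n - 1}(𝓔)` that `dl` gives rise to, where `l` is the restriction of `L + θ` to `𝓔`. -/
def IsPresymplectic (S : Set (Jet n m V)) (L θ : JetForms n m V n) (Ω : VinE S 1 2 (n + 1)) :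
    Prop :=
  IsClassOf _ _ (dOn (vanishingIdeal S) n (restrictForm (vanishingIdeal S) n (L + θ))) Ω

end Bundle

end JetGeom

/-! The value of a form at a jet depends on finitely many numbers only, the derivatives of finitely
many functions along the arguments. As far as these are concerned, each vector field is at the given
jet the sum of a lift to the Cartan distribution of a field `W` of the base and of the evolutionary
field `E_τ` of a section `τ` of the bundle, and these two commute. Hence `d(L + θ)` lies in
`𝓒²` at a jet of `𝓔` once it is zero on `n + 1` lifts, which holds because they are linearly
dependent there, and on `E_τ` and `n` lifts. For the latter use Cartan's formula
`E_τ ⌟ d(L + θ) = 𝓛_{E_τ} (L + θ) - d(E_τ ⌟ (L + θ))`. On lifts `𝓛_{E_τ} θ` is zero, because `θ` is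
zero on them and they commute with `E_τ`. As `E_τ ⌟ L = 0`, the Noether formula leaves
`⟨E(L), τ⟩`, which is zero on `𝓔`.

Since `θ` is in `𝓒¹`, the forms `L` and `l` represent the same element of `E₁^{0,n}`. If this
element, or the element of `E₂^{0,n}` that it represents, were zero, then `dl = dc` for some `c` in
`𝓒¹`, so the class of `dl` in `E₁^{2,n-1}` would be in the image of `d₁`, and its class in
`E₂^{2,n-1}` would be zero. -/

namespace DiffCalc

section AlternatingForms

variable {A : Type*} [CommRing A] [Algebra ℝ A]

theorem exists_alternatingMap_of_mem_forms {k : ℕ} {θ : Cochain A k} (hθ : θ ∈ Forms A k)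
    {B : Type*} [CommRing B] (ev : A →+* B) :
    ∃ (N : ℕ) (g : Fin N × Fin k → A) (Φ : (Fin N × Fin k → B) [⋀^Fin k]→ₗ[B] B),
      ∀ X, ev (θ X) = Φ fun a i => ev (X a (g i)) := by
  obtain ⟨N, f, g, rfl⟩ := Submodule.mem_span_set'.1 hθ
  choose g' hg' using fun i => (g i).2
  let Ψ (i : Fin N) : (Fin N × Fin k → B) [⋀^Fin k]→ₗ[B] B := ev (f i) •
    Matrix.detRowAlternating.compLinearMap (LinearMap.funLeft B B fun b => (i, b))
  let evalAt (x : Fin k → Fin N × Fin k → B) : (Fin N × Fin k → B) [⋀^Fin k]→ₗ[B] B →+ B :=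
    ⟨⟨fun Φ => Φ x, rfl⟩, fun _ _ => rfl⟩
  refine ⟨N, fun i => g' i.1 i.2, ∑ i, Ψ i, fun X => ?_⟩
  simp only [← hg', wedgeD, Finset.sum_apply, Pi.smul_apply, smul_eq_mul, map_sum, map_mul,
    RingHom.map_det]
  exact (map_sum (evalAt fun a i => ev (X a (g' i.1 i.2))) Ψ _).symm

theorem exists_alternatingMap_eq {k : ℕ} {θ : Cochain A k} (hθ : θ ∈ Forms A k) :
    ∃ Φ : (A → A) [⋀^Fin k]→ₗ[A] A, ∀ X, θ X = Φ fun a => X a := by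
  obtain ⟨N, g, Φ, hΦ⟩ := exists_alternatingMap_of_mem_forms hθ (RingHom.id A)
  exact ⟨Φ.compLinearMap (LinearMap.funLeft A A g), hΦ⟩

end AlternatingForms

section SpectralSequence

variable {C : ℕ → Type*} [∀ k, AddCommGroup (C k)] [∀ k, Module ℝ (C k)]
  {d : ∀ k, C k →ₗ[ℝ] C (k + 1)} {F : ℕ → ∀ k, Submodule ℝ (C k)}

theorem mk_eq_mk_iff {r p k : ℕ} {z w : C k} (hz : z ∈ cyc d F r p k) (hw : w ∈ cyc d F r p k) :
    (Submodule.Quotient.mk ⟨z, hz⟩ : Page d F r p k) = Submodule.Quotient.mk ⟨w, hw⟩ ↔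
      z - w ∈ bnd d F r p k := by
  rw [Submodule.Quotient.eq]; rfl

theorem mk_eq_zero_iff {r p k : ℕ} {z : C k} (hz : z ∈ cyc d F r p k) :
    (Submodule.Quotient.mk ⟨z, hz⟩ : Page d F r p k) = 0 ↔ z ∈ bnd d F r p k := by
  rw [Submodule.Quotient.mk_eq_zero]; rfl

theorem mem_bnd_of_mem_succ {r p k : ℕ} {c : C k} (hc : c ∈ F (p + 1) k)
    (hdc : d k c ∈ F (p + r) (k + 1)) : c ∈ bnd d F r p k := by
  cases k with
  | zero => exact ⟨hc, hdc⟩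
  | succ k => exact Submodule.mem_sup_left ⟨hc, hdc⟩

theorem exists_d_eq_of_isClassOf_zero (hd : ∀ k z, d (k + 1) (d k z) = 0) {r p k : ℕ} {z : C k}
    (hz : IsClassOf d F z (0 : Page d F r p k)) : ∃ c ∈ F (p + 1) k, d k c = d k z := by
  obtain ⟨hz, hz0⟩ := hz
  have hzb := (mk_eq_zero_iff hz).1 hz0.symm
  cases k with
  | zero => exact ⟨z, hzb.1, rfl⟩
  | succ k =>
    obtain ⟨c, hc, _, ⟨_, b, _, rfl⟩, rfl⟩ := Submodule.mem_sup.1 hzb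
    exact ⟨c, hc.1, by rw [map_add, hd, add_zero]⟩

theorem exists_represents_d (hd : ∀ k z, d (k + 1) (d k z) = 0) (r : ℕ) {p k : ℕ} {z : C k}
    (hz : d k z ∈ F p (k + 1)) :
    ∃ (x : Page d F r p (k + 1)) (y : Page d F (r + 1) p (k + 1)),
      IsClassOf d F (d k z) x ∧ pageD d F hd r p (k + 1) x = 0 ∧ Represents d F x y := by
  have hcyc : ∀ r, d k z ∈ cyc d F r p (k + 1) := fun r => ⟨hz, by simp [hd]⟩
  refine ⟨_, _, ⟨hcyc r, rfl⟩, ?_, _, ⟨hcyc r, rfl⟩, ⟨hcyc (r + 1), rfl⟩⟩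
  refine (Submodule.mapQ_apply _ _ _ _).trans ((Submodule.Quotient.mk_eq_zero _).2 ?_)
  change d (k + 1) (d k z) ∈ bnd d F r (p + r) (k + 1 + 1)
  rw [hd]
  exact Submodule.zero_mem _

theorem eq_zero_of_represents_d (hd : ∀ k z, d (k + 1) (d k z) = 0)
    (hF : ∀ k, Antitone fun p => F p k) {r p k : ℕ} {c : C k} (hc : c ∈ F (p - r) k)
    {x : Page d F r p (k + 1)} {y : Page d F (r + 1) p (k + 1)}
    (hx : IsClassOf d F (d k c) x) (hxy : Represents d F x y) : y = 0 := by
  obtain ⟨hcx, rfl⟩ := hx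
  obtain ⟨z, ⟨hzx, hzc⟩, hzy, rfl⟩ := hxy
  obtain ⟨a, ha, _, ⟨_, b, hb, rfl⟩, hab⟩ :=
    Submodule.mem_sup.1 ((mk_eq_mk_iff hzx hcx).1 hzc.symm)
  have hz : z = a + d k (b + c) := by rw [map_add, ← add_assoc, hab, sub_add_cancel]
  have hdz : d (k + 1) z = d (k + 1) a := by rw [hz, map_add, hd, add_zero]
  have hbc : b + c ∈ F (p + 1 - (r + 1)) k := by
    rw [Nat.add_sub_add_right]
    exact Submodule.add_mem _ (hF k (by omega) hb) hc
  have haF : a ∈ F p (k + 1) := hF (k + 1) (Nat.le_succ p) ha.1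
  refine (mk_eq_zero_iff hzy).2 (hz ▸ Submodule.add_mem_sup ⟨ha.1, ?_⟩ ⟨?_, b + c, hbc, rfl⟩)
  · exact (hdz ▸ hzy.2 : d (k + 1) a ∈ F (p + (r + 1)) (k + 1 + 1))
  · exact sub_eq_iff_eq_add'.2 hz ▸ Submodule.sub_mem _ hzy.1 haF

theorem exists_represents_ne_zero (hd : ∀ k z, d (k + 1) (d k z) = 0) (hF₀ : ∀ k, F 0 k = ⊤)
    {n : ℕ} (hF₁ : F 1 (n + 1) = ⊤) {L θ : C n} (hθ : θ ∈ F 1 n)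
    (hl : d n (L + θ) ∈ F 2 (n + 1)) (hne : ∀ c ∈ F 1 n, d n c ≠ d n (L + θ)) :
    ∃ (e₀ : Page d F 0 0 n) (e₁ : Page d F 1 0 n) (e₂ : Page d F 2 0 n),
      IsClassOf d F L e₀ ∧ Represents d F e₀ e₁ ∧ e₁ ≠ 0 ∧ Represents d F e₁ e₂ ∧ e₂ ≠ 0 := by
  have hL₀ : L ∈ cyc d F 0 0 n := ⟨by simp [hF₀], by simp [hF₀]⟩
  have hL₁ : L ∈ cyc d F 1 0 n := ⟨by simp [hF₀], by simp [hF₁]⟩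
  have hl₁ : L + θ ∈ cyc d F 1 0 n := ⟨by simp [hF₀], by simp [hF₁]⟩
  have hl₂ : L + θ ∈ cyc d F 2 0 n := ⟨by simp [hF₀], by simpa using hl⟩
  have hLl : (Submodule.Quotient.mk ⟨L, hL₁⟩ : Page d F 1 0 n) =
      Submodule.Quotient.mk ⟨L + θ, hl₁⟩ := by
    rw [mk_eq_mk_iff, sub_add_cancel_left, neg_mem_iff]
    exact mem_bnd_of_mem_succ hθ (by simp [hF₁])
  have hne_zero : ∀ {r} {e : Page d F r 0 n}, IsClassOf d F (L + θ) e → e ≠ 0 := by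
    rintro r _ he rfl
    obtain ⟨c, hc, hcl⟩ := exists_d_eq_of_isClassOf_zero hd he
    exact hne c hc hcl
  exact ⟨_, _, _, ⟨hL₀, rfl⟩, ⟨L, ⟨hL₀, rfl⟩, ⟨hL₁, rfl⟩⟩, hne_zero ⟨hl₁, hLl⟩,
    ⟨L + θ, ⟨hl₁, hLl⟩, ⟨hl₂, rfl⟩⟩, hne_zero ⟨hl₂, rfl⟩⟩

end SpectralSequence

end DiffCalc

namespace JetGeom

section Calculus

section Integral

variable {P F : Type*} [NormedAddCommGroup P] [NormedSpace ℝ P] [FiniteDimensional ℝ P]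
  [NormedAddCommGroup F] [NormedSpace ℝ F] {Φ : P × ℝ → F}

theorem hasFDerivAt_intervalIntegral (hΦ : ContDiff ℝ 1 Φ) (a b : ℝ) (x : P) :
    HasFDerivAt (fun x => ∫ t in a..b, Φ (x, t))
      (∫ t in a..b, (fderiv ℝ Φ (x, t)).comp (ContinuousLinearMap.inl ℝ P ℝ)) x := by
  have hΨ : Continuous fun q : P × ℝ =>
      (fderiv ℝ Φ q).comp (ContinuousLinearMap.inl ℝ P ℝ) :=
    (hΦ.continuous_fderiv one_ne_zero).clm_comp continuous_const
  have hcont : ∀ y, Continuous fun t => Φ (y, t) := fun y => hΦ.continuous.comp (by fun_prop)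
  obtain ⟨C, hC⟩ := ((isCompact_closedBall x 1).prod
    (isCompact_uIcc (a := a) (b := b))).exists_bound_of_continuousOn hΨ.continuousOn
  exact intervalIntegral.hasFDerivAt_integral_of_dominated_of_fderiv_le
    (F := fun x t => Φ (x, t)) (bound := fun _ => C) (Metric.closedBall_mem_nhds x one_pos)
    (.of_forall fun y => (hcont y).aestronglyMeasurable) ((hcont x).intervalIntegrable _ _)
    (hΨ.comp (by fun_prop : Continuous fun t : ℝ => (x, t))).aestronglyMeasurable
    (.of_forall fun t ht y hy => hC (y, t) ⟨hy, Set.uIoc_subset_uIcc ht⟩) (by simp)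
    (.of_forall fun t _ y _ => (hΦ.differentiable one_ne_zero (y, t)).hasFDerivAt.comp y
      (hasFDerivAt_prodMk_left y t))

theorem contDiff_intervalIntegral (hΦ : ContDiff ℝ ∞ Φ) (a b : ℝ) :
    ContDiff ℝ ∞ fun x => ∫ t in a..b, Φ (x, t) := by
  refine contDiff_infty.2 fun N => ?_
  induction N generalizing Φ with
  | zero =>
    exact contDiff_zero.2 (intervalIntegral.continuous_parametric_intervalIntegral_of_continuous'
      (f := fun x t => Φ (x, t)) hΦ.continuous a b)
  | succ N ih =>
    have hderiv := hasFDerivAt_intervalIntegral (hΦ.of_le (mod_cast le_top)) a b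
    refine contDiff_succ_iff_fderiv_apply (n := N).2
      ⟨fun x => (hderiv x).differentiableAt, by simp, fun v => ?_⟩
    have hΨ : ContDiff ℝ ∞ (fderiv ℝ Φ) := hΦ.fderiv_right (by simp)
    convert! ih (hΨ.clm_apply (contDiff_const (c := (v, (0 : ℝ))))) using 2 with x
    rw [(hderiv x).fderiv, ContinuousLinearMap.intervalIntegral_apply]
    · simp
    · exact ((hΨ.continuous.comp (by fun_prop)).clm_comp continuous_const).intervalIntegrable _ _

end Integral

theorem exists_hadamard {ι : Type*} [Fintype ι] {H : (ι → ℝ) → ℝ} (hH : ContDiff ℝ ∞ H)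
    (z₀ : ι → ℝ) : ∃ h : ι → (ι → ℝ) → ℝ, (∀ i, ContDiff ℝ ∞ (h i)) ∧
      ∀ z, H z = H z₀ + ∑ i, (z i - z₀ i) * h i z := by
  classical
  have hsm : ∀ i, ContDiff ℝ ∞ fun q : (ι → ℝ) × ℝ =>
      fderiv ℝ H (z₀ + q.2 • (q.1 - z₀)) (Pi.single i 1) := fun i =>
    ((hH.fderiv_right (m := ∞) (by simp)).comp (by fun_prop)).clm_apply contDiff_const
  refine ⟨_, fun i => contDiff_intervalIntegral (hsm i) 0 1, fun z => ?_⟩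
  have hintegrable : ∀ i, IntervalIntegrable (fun t : ℝ => (z i - z₀ i) *
      fderiv ℝ H (z₀ + t • (z - z₀)) (Pi.single i 1)) MeasureTheory.volume 0 1 := fun i =>
    (continuous_const.mul ((hsm i).continuous.comp
      (by fun_prop : Continuous fun t : ℝ => (z, t)))).intervalIntegrable _ _
  have htaylor := map_add_eq_sum_add_integral_iteratedFDeriv (n := 0) (y := z - z₀)
    fun t _ => (hH.of_le (by simp)).contDiffAt (x := z₀ + t • (z - z₀))
  have hsum : ∀ p, fderiv ℝ H p (z - z₀) =
      ∑ i, (z i - z₀ i) * fderiv ℝ H p (Pi.single i 1) := fun p => by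
    rw [congrArg (fderiv ℝ H p) (pi_eq_sum_univ' (z - z₀)), map_sum]
    simp
  simpa [hsum, intervalIntegral.integral_finsetSum fun i _ => hintegrable i] using htaylor

variable {P : Type*} [NormedAddCommGroup P] [NormedSpace ℝ P] {O : Set P}

theorem lineDeriv_eq_fderiv_of_contDiffOn (hO : IsOpen O) {Φ : P → ℝ} (hΦ : ContDiffOn ℝ ∞ Φ O)
    {p : P} (hp : p ∈ O) (a : P) : lineDeriv ℝ Φ p a = fderiv ℝ Φ p a :=
  ((hΦ.contDiffAt (hO.mem_nhds hp)).differentiableAt (by simp)).lineDeriv_eq_fderiv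

theorem contDiffOn_fderiv_apply_const {F : Type*} [NormedAddCommGroup F] [NormedSpace ℝ F]
    (hO : IsOpen O) {Φ : P → F} (hΦ : ContDiffOn ℝ ∞ Φ O) (a : P) :
    ContDiffOn ℝ ∞ (fun q => fderiv ℝ Φ q a) O :=
  (hΦ.fderiv_of_isOpen hO (by simp)).clm_apply contDiffOn_const

theorem fderiv_fderiv_comm (hO : IsOpen O) {Φ : P → ℝ} (hΦ : ContDiffOn ℝ ∞ Φ O) {p : P}
    (hp : p ∈ O) (a b : P) :
    fderiv ℝ (fun q => fderiv ℝ Φ q a) p b = fderiv ℝ (fun q => fderiv ℝ Φ q b) p a := by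
  have hd : DifferentiableAt ℝ (fderiv ℝ Φ) p :=
    ((hΦ.fderiv_of_isOpen hO (m := ∞) (by simp)).contDiffAt (hO.mem_nhds hp)).differentiableAt
      (by simp)
  have hsymm : IsSymmSndFDerivAt ℝ Φ p := (hΦ.contDiffAt (hO.mem_nhds hp)).isSymmSndFDerivAt
    (by simpa using (mod_cast le_top : ((2 : ℕ∞) : WithTop ℕ∞) ≤ ∞))
  have hsnd : ∀ c e : P, fderiv ℝ (fun q => fderiv ℝ Φ q c) p e =
      fderiv ℝ (fderiv ℝ Φ) p e c := fun c e => by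
    rw [fderiv_clm_apply hd (differentiableAt_const c)]
    simp
  rw [hsnd, hsnd, hsymm.eq]

theorem deriv_fderiv_comm (hO : IsOpen O) {Φ : ℝ × P → ℝ}
    (hΦ : ContDiffOn ℝ ∞ Φ (Set.univ ×ˢ O)) (ε : ℝ) {p : P} (hp : p ∈ O) (a : P) :
    deriv (fun δ => fderiv ℝ (fun q => Φ (δ, q)) p a) ε =
      fderiv ℝ (fun q => deriv (fun δ => Φ (δ, q)) ε) p a := by
  have hUO : IsOpen ((Set.univ : Set ℝ) ×ˢ O) := isOpen_univ.prod hO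
  have hderiv : ∀ {Ψ : ℝ × P → ℝ}, ContDiffOn ℝ ∞ Ψ (Set.univ ×ˢ O) → ∀ δ, ∀ q ∈ O,
      deriv (fun δ => Ψ (δ, q)) δ = fderiv ℝ Ψ (δ, q) (1, 0) ∧
        fderiv ℝ (fun q => Ψ (δ, q)) q a = fderiv ℝ Ψ (δ, q) (0, a) := fun hΨ δ q hq => by
    have hd := ((hΨ.contDiffAt (hUO.mem_nhds (x := (δ, q)) ⟨trivial, hq⟩)).differentiableAt
      (by simp)).hasFDerivAt
    exact ⟨(hd.comp_hasDerivAt δ ((hasDerivAt_id δ).prodMk (hasDerivAt_const δ q))).deriv,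
      congrArg (· a) (hd.comp q (hasFDerivAt_prodMk_right δ q)).fderiv⟩
  have hsm := contDiffOn_fderiv_apply_const hUO hΦ
  have hcongr : (fun q => deriv (fun δ => Φ (δ, q)) ε) =ᶠ[nhds p]
      fun q => fderiv ℝ Φ (ε, q) (1, 0) := by
    filter_upwards [hO.mem_nhds hp] with q hq using (hderiv hΦ ε q hq).1
  simp only [fun δ => (hderiv hΦ δ p hp).2]
  rw [(hderiv (hsm _) ε p hp).1, hcongr.fderiv_eq, (hderiv (hsm _) ε p hp).2,
    fderiv_fderiv_comm hUO hΦ ⟨trivial, hp⟩]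

end Calculus

section IterOps

theorem foldr_iterate_rel {ι β γ : Type*} {T : ι → β → β} {T' : ι → γ → γ} (R : β → γ → Prop)
    (hR : ∀ j b c, R b c → R (T j b) (T' j c)) (α : ι → ℕ) (l : List ι) {b : β} {c : γ}
    (h : R b c) :
    R (l.foldr (fun j => (T j)^[α j]) b) (l.foldr (fun j => (T' j)^[α j]) c) := by
  have hiter : ∀ j k b c, R b c → R ((T j)^[k] b) ((T' j)^[k] c) := by
    intro j k b c h
    induction k generalizing b c with
    | zero => exact h
    | succ _ ih => exact ih _ _ (hR j b c h)
  induction l with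
  | nil => exact h
  | cons j l ih => exact hiter _ _ _ _ ih

variable {n : ℕ} {β γ : Type*}

theorem iterOps_eq_foldr (T : Fin n → β → β) (α : Fin n → ℕ) (b : β) :
    iterOps T α b = (List.finRange n).foldr (fun j => (T j)^[α j]) b := by
  rw [iterOps, List.ofFn_eq_map, List.foldr_map]

theorem iterOps_zero (T : Fin n → β → β) (b : β) : iterOps T 0 b = b := by
  rw [iterOps_eq_foldr]
  induction List.finRange n with
  | nil => rfl
  | cons _ _ ih => exact ih

theorem iterOps_rel {T : Fin n → β → β} {T' : Fin n → γ → γ} (R : β → γ → Prop)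
    (hR : ∀ j b c, R b c → R (T j b) (T' j c)) (α : Fin n → ℕ) {b : β} {c : γ} (h : R b c) :
    R (iterOps T α b) (iterOps T' α c) := by
  rw [iterOps_eq_foldr, iterOps_eq_foldr]
  exact foldr_iterate_rel R hR α _ h

theorem iterOps_induction {T : Fin n → β → β} (P : β → Prop) (hP : ∀ j b, P b → P (T j b))
    (α : Fin n → ℕ) {b : β} (h : P b) : P (iterOps T α b) :=
  iterOps_rel (T' := fun _ => id) (fun b (_ : Unit) => P b) (fun j b _ => hP j b) α (c := ()) h

theorem iterOps_prodMap (T : Fin n → β → β) (T' : Fin n → γ → γ) (α : Fin n → ℕ) (b : β) (c : γ) :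
    iterOps (fun j => Prod.map (T j) (T' j)) α (b, c) = (iterOps T α b, iterOps T' α c) :=
  Prod.ext
    (iterOps_rel (fun p b => p.1 = b) (fun j _ _ h => congrArg (T j) h) α (b := (b, c)) rfl)
    (iterOps_rel (fun p c => p.2 = c) (fun j _ _ h => congrArg (T' j) h) α (b := (b, c)) rfl)

theorem iterOps_update (D : β → β) (α : Fin n → ℕ) (p : Fin n → β) :
    iterOps (fun j p => Function.update p j (D (p j))) α p = fun i => D^[α i] (p i) := by
  have hiter : ∀ j k (p : Fin n → β), (fun p => Function.update p j (D (p j)))^[k] p =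
      Function.update p j (D^[k] (p j)) := by
    intro j k
    induction k with
    | zero => simp
    | succ k ih => intro p; simp [ih]
  have hfold : ∀ l : List (Fin n), l.Nodup →
      l.foldr (fun j => (fun p => Function.update p j (D (p j)))^[α j]) p =
        fun i => if i ∈ l then D^[α i] (p i) else p i := by
    intro l hl
    induction l with
    | nil => simp
    | cons j l ih =>
      obtain ⟨hj, hl⟩ := List.nodup_cons.1 hl
      rw [List.foldr_cons, ih hl, hiter]
      funext i
      by_cases hij : i = j
      · subst hij; simp [hj]
      · simp [hij]
  rw [iterOps_eq_foldr, hfold _ (List.nodup_finRange n)]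
  simp

theorem iterOps_add_single_rel {T : Fin n → β → β} {j : Fin n} (P : β → Prop) (R : β → β → Prop)
    (hP : ∀ k b, P b → P (T k b)) (hj : ∀ b, P b → R (T j b) b)
    (hR : ∀ k b c, R b c → R (T k b) (T k c)) (α : Fin n → ℕ) {b : β} (hb : P b) :
    R (iterOps T (α + Pi.single j 1) b) (iterOps T α b) := by
  have hne : ∀ k, k ≠ j → (α + Pi.single j 1 : Fin n → ℕ) k = α k := fun k hk => by simp [hk]
  obtain ⟨l₁, l₂, hl⟩ := List.append_of_mem (List.mem_finRange j)
  have hnodup := List.nodup_finRange n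
  rw [hl, List.nodup_middle, List.nodup_cons, List.mem_append, not_or] at hnodup
  have hfold : ∀ l : List (Fin n), j ∉ l → ∀ b,
      l.foldr (fun k => (T k)^[(α + Pi.single j 1 : Fin n → ℕ) k]) b =
        l.foldr (fun k => (T k)^[α k]) b :=
    fun l hl b => List.foldr_ext _ _ _ fun k hk c => by rw [hne k (ne_of_mem_of_not_mem hk hl)]
  have hPl : P (l₂.foldr (fun k => (T k)^[α k]) b) :=
    foldr_iterate_rel (T' := T) (fun b _ => P b) (fun k b _ => hP k b) α l₂ (c := b) hb
  rw [iterOps_eq_foldr, iterOps_eq_foldr, hl, List.foldr_append, List.foldr_append,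
    List.foldr_cons, List.foldr_cons, hfold _ hnodup.1.1, hfold _ hnodup.1.2]
  refine foldr_iterate_rel R hR α l₁ ?_
  simp only [Pi.add_apply, Pi.single_eq_same, Function.iterate_succ_apply]
  exact foldr_iterate_rel R hR α [j] (hj _ hPl)

end IterOps

section BasePartial

variable {n : ℕ} {O : Set (EuclideanSpace ℝ (Fin n))}

local notation "𝔼" => EuclideanSpace ℝ (Fin n)

theorem basePartial_eq_fderiv (hO : IsOpen O) {h : 𝔼 → ℝ} (hh : ContDiffOn ℝ ∞ h O) {y : 𝔼}
    (hy : y ∈ O) (j : Fin n) : basePartial j h y = fderiv ℝ h y (EuclideanSpace.single j 1) :=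
  lineDeriv_eq_fderiv_of_contDiffOn hO hh hy _

theorem basePartial_congr (hO : IsOpen O) {h h' : 𝔼 → ℝ} (hh : Set.EqOn h h' O) (j : Fin n) :
    Set.EqOn (basePartial j h) (basePartial j h') O := fun _ hy =>
  (hh.eventuallyEq_of_mem (hO.mem_nhds hy)).lineDeriv_eq

theorem contDiffOn_basePartial (hO : IsOpen O) {h : 𝔼 → ℝ} (hh : ContDiffOn ℝ ∞ h O)
    (j : Fin n) : ContDiffOn ℝ ∞ (basePartial j h) O :=
  (contDiffOn_fderiv_apply_const hO hh _).congr fun _ hy => basePartial_eq_fderiv hO hh hy j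

theorem basePartial_add_smul (hO : IsOpen O) {h h' : 𝔼 → ℝ} (hh : ContDiffOn ℝ ∞ h O)
    (hh' : ContDiffOn ℝ ∞ h' O) (c : ℝ) (j : Fin n) :
    Set.EqOn (basePartial j (h + c • h')) (basePartial j h + c • basePartial j h') O := by
  intro y hy
  have d := (hh.contDiffAt (hO.mem_nhds hy)).differentiableAt (by simp)
  have d' := (hh'.contDiffAt (hO.mem_nhds hy)).differentiableAt (by simp)
  have hsum : ContDiffOn ℝ ∞ (h + c • h') O := hh.add (hh'.const_smul c)
  rw [Pi.add_apply, Pi.smul_apply, basePartial_eq_fderiv hO hsum hy,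
    basePartial_eq_fderiv hO hh hy, basePartial_eq_fderiv hO hh' hy,
    fderiv_add d (d'.const_smul c), fderiv_const_smul d']
  simp

theorem basePartial_comm (hO : IsOpen O) {h : 𝔼 → ℝ} (hh : ContDiffOn ℝ ∞ h O) (i j : Fin n) :
    Set.EqOn (basePartial i (basePartial j h)) (basePartial j (basePartial i h)) O := by
  have hsnd : ∀ i j : Fin n, ∀ y ∈ O, basePartial i (basePartial j h) y =
      fderiv ℝ (fun q => fderiv ℝ h q (EuclideanSpace.single j 1)) y
        (EuclideanSpace.single i 1) := fun i j y hy => by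
    rw [basePartial_congr hO (fun z hz => basePartial_eq_fderiv hO hh hz j) i hy,
      basePartial_eq_fderiv hO (contDiffOn_fderiv_apply_const hO hh _) hy]
  intro y hy
  rw [hsnd i j y hy, hsnd j i y hy, fderiv_fderiv_comm hO hh hy]

theorem contDiffOn_iterOps_basePartial (hO : IsOpen O) {h : 𝔼 → ℝ} (hh : ContDiffOn ℝ ∞ h O)
    (α : Fin n → ℕ) : ContDiffOn ℝ ∞ (iterOps basePartial α h) O :=
  iterOps_induction (ContDiffOn ℝ ∞ · O) (fun j _ h => contDiffOn_basePartial hO h j) α hh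

theorem iterOps_basePartial_congr (hO : IsOpen O) {h h' : 𝔼 → ℝ} (hh : Set.EqOn h h' O)
    (α : Fin n → ℕ) : Set.EqOn (iterOps basePartial α h) (iterOps basePartial α h') O :=
  iterOps_rel (fun h h' => Set.EqOn h h' O) (fun j _ _ h => basePartial_congr hO h j) α hh

theorem iterOps_basePartial_zero (α : Fin n → ℕ) : iterOps basePartial α (0 : 𝔼 → ℝ) = 0 :=
  iterOps_induction (· = 0) (fun j h hh => by ext; simp [hh, basePartial, lineDeriv]) α rfl

theorem iterOps_basePartial_add_smul (hO : IsOpen O) {h h' : 𝔼 → ℝ} (hh : ContDiffOn ℝ ∞ h O)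
    (hh' : ContDiffOn ℝ ∞ h' O) (c : ℝ) (α : Fin n → ℕ) :
    Set.EqOn (iterOps basePartial α (h + c • h'))
      (iterOps basePartial α h + c • iterOps basePartial α h') O := by
  have hpair := iterOps_rel (T := fun j : Fin n => Prod.map (basePartial j) (basePartial j))
    (fun p g => ContDiffOn ℝ ∞ p.1 O ∧ ContDiffOn ℝ ∞ p.2 O ∧ Set.EqOn g (p.1 + c • p.2) O)
    (fun j p g ⟨h₁, h₂, hg⟩ => ⟨contDiffOn_basePartial hO h₁ j, contDiffOn_basePartial hO h₂ j,
      (basePartial_congr hO hg j).trans (basePartial_add_smul hO h₁ h₂ c j)⟩)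
    α (b := (h, h')) ⟨hh, hh', fun _ _ => rfl⟩
  rw [iterOps_prodMap] at hpair
  exact hpair.2.2

theorem iterOps_basePartial_add_single (hO : IsOpen O) {h : 𝔼 → ℝ} (hh : ContDiffOn ℝ ∞ h O)
    (α : Fin n → ℕ) (j : Fin n) :
    Set.EqOn (iterOps basePartial (α + Pi.single j 1) h)
      (basePartial j (iterOps basePartial α h)) O :=
  (iterOps_add_single_rel (ContDiffOn ℝ ∞ · O)
    (fun g h => ContDiffOn ℝ ∞ h O ∧ Set.EqOn g (basePartial j h) O)
    (fun k _ hg => contDiffOn_basePartial hO hg k) (fun _ hg => ⟨hg, fun _ _ => rfl⟩)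
    (fun k _ _ ⟨hh, hgh⟩ => ⟨contDiffOn_basePartial hO hh k,
      (basePartial_congr hO hgh k).trans (basePartial_comm hO hh k j)⟩) α hh).2

theorem basePartial_prod_eval (p : Fin n → Polynomial ℝ) (j : Fin n) :
    basePartial j (fun y : 𝔼 => ∏ i, (p i).eval (y i)) =
      fun y => ∏ i, (Function.update p j (Polynomial.derivative (p j)) i).eval (y i) := by
  funext y
  have hline : ∀ t : ℝ, ∏ i, (p i).eval ((y + t • EuclideanSpace.single j (1 : ℝ)) i) =
      (p j).eval (y j + t) * ∏ i ∈ Finset.univ.erase j, (p i).eval (y i) := fun t => by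
    rw [← Finset.mul_prod_erase _ _ (Finset.mem_univ j)]
    congr 1
    · simp
    · exact Finset.prod_congr rfl fun i hi => by simp [Finset.ne_of_mem_erase hi]
  have hderiv : HasDerivAt (fun t : ℝ => (p j).eval (y j + t))
      ((Polynomial.derivative (p j)).eval (y j)) 0 := by
    simpa using (p j).hasDerivAt (y j + 0) |>.comp_const_add (y j) 0
  simp only [basePartial, lineDeriv, hline]
  rw [(hderiv.mul_const _).deriv, ← Finset.mul_prod_erase Finset.univ _ (Finset.mem_univ j),
    Function.update_self]
  congr 1
  exact Finset.prod_congr rfl fun i hi => by rw [Function.update_of_ne (Finset.ne_of_mem_erase hi)]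

theorem iterOps_basePartial_prod_eval (p : Fin n → Polynomial ℝ) (α : Fin n → ℕ) :
    iterOps basePartial α (fun y : 𝔼 => ∏ i, (p i).eval (y i)) =
      fun y => ∏ i, ((Polynomial.derivative^[α i]) (p i)).eval (y i) := by
  have h := iterOps_rel (T := basePartial)
    (fun h p => h = fun y : 𝔼 => ∏ i, (Polynomial.eval (y i) (p i)))
    (fun j _ p h => h ▸ basePartial_prod_eval p j) α (c := p) rfl
  rwa [iterOps_update] at h

theorem eval_iterate_derivative_monomial (x : ℝ) (a b : ℕ) :
    (Polynomial.derivative^[a] (Polynomial.C (b.factorial : ℝ)⁻¹ *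
      (Polynomial.X - Polynomial.C x) ^ b)).eval x = if a = b then 1 else 0 := by
  rw [Polynomial.iterate_derivative_C_mul, Polynomial.iterate_derivative_X_sub_pow]
  rcases lt_trichotomy a b with h | rfl | h
  · simp [h.ne, (Nat.sub_pos_of_lt h).ne']
  · simp [Nat.descFactorial_self, a.factorial_ne_zero]
  · simp [h.ne', Nat.descFactorial_of_lt h]

theorem exists_iterOps_basePartial_eq_ite (y₀ : 𝔼) (β : Fin n → ℕ) :
    ∃ h : 𝔼 → ℝ, ContDiff ℝ ∞ h ∧ ∀ α, iterOps basePartial α h y₀ = if α = β then 1 else 0 := by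
  refine ⟨fun y => ∏ i, (Polynomial.C ((β i).factorial : ℝ)⁻¹ *
    (Polynomial.X - Polynomial.C (y₀ i)) ^ β i).eval (y i), contDiff_prod fun i _ => ?_,
    fun α => ?_⟩
  · simp only [Polynomial.eval_mul, Polynomial.eval_pow, Polynomial.eval_sub, Polynomial.eval_C,
      Polynomial.eval_X]
    fun_prop
  · simp only [iterOps_basePartial_prod_eval, eval_iterate_derivative_monomial,
      Finset.prod_ite_zero, Finset.mem_univ, true_imp_iff, Finset.prod_const_one, funext_iff]

theorem exists_iterOps_basePartial_eq (y₀ : 𝔼) (s : Finset (Fin n → ℕ)) (c : (Fin n → ℕ) → ℝ) :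
    ∃ h : 𝔼 → ℝ, ContDiff ℝ ∞ h ∧
      ∀ α, iterOps basePartial α h y₀ = if α ∈ s then c α else 0 := by
  choose e he heα using exists_iterOps_basePartial_eq_ite y₀
  induction s using Finset.induction_on with
  | empty => exact ⟨0, contDiff_const, fun α => by simp [iterOps_basePartial_zero]⟩
  | insert β s hβ ih =>
    obtain ⟨g, hg, hgα⟩ := ih
    refine ⟨g + c β • e β, hg.add (contDiff_const.smul (he β)), fun α => ?_⟩
    rw [iterOps_basePartial_add_smul isOpen_univ hg.contDiffOn (he β).contDiffOn _ α
      (Set.mem_univ y₀), Pi.add_apply, Pi.smul_apply, hgα, heα]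
    by_cases hαβ : α = β
    · subst hαβ; simp [hβ]
    · simp [hαβ]

end BasePartial

section JetFunctions

variable {n m : ℕ} {M : Type*} [TopologicalSpace M] [ChartedSpace (EuclideanSpace ℝ (Fin n)) M]

local notation "𝔼" => EuclideanSpace ℝ (Fin n)
local notation "ch" => chartAt (EuclideanSpace ℝ (Fin n))

section

variable (V : M → Type*) [TopologicalSpace (Bundle.TotalSpace (Fin m → ℝ) V)]
  [∀ x, TopologicalSpace (V x)] [FiberBundle (Fin m → ℝ) V]

variable (n m) in
/-- The range of the adapted coordinates on the base. -/
def coordDom (x₀ : M) : Set 𝔼 := ch x₀ '' adaptedDom n m V x₀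

theorem adaptedDom_subset_source (x₀ : M) : adaptedDom n m V x₀ ⊆ (ch x₀).source :=
  Set.inter_subset_left

theorem isOpen_adaptedDom (x₀ : M) : IsOpen (adaptedDom n m V x₀) :=
  (ch x₀).open_source.inter (trivializationAt (Fin m → ℝ) V x₀).open_baseSet

theorem mem_adaptedDom_self (x₀ : M) : x₀ ∈ adaptedDom n m V x₀ :=
  ⟨mem_chart_source _ x₀, FiberBundle.mem_baseSet_trivializationAt' x₀⟩

theorem isOpen_coordDom (x₀ : M) : IsOpen (coordDom n m V x₀) :=
  (ch x₀).isOpen_image_of_subset_source (isOpen_adaptedDom V x₀) (adaptedDom_subset_source V x₀)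

variable {V}

theorem chart_mem_coordDom {x₀ x : M} (hx : x ∈ adaptedDom n m V x₀) :
    ch x₀ x ∈ coordDom n m V x₀ := ⟨x, hx, rfl⟩

theorem symm_mem_adaptedDom {x₀ : M} {z : 𝔼} (hz : z ∈ coordDom n m V x₀) :
    (ch x₀).symm z ∈ adaptedDom n m V x₀ := by
  obtain ⟨x, hx, rfl⟩ := hz
  rwa [(ch x₀).left_inv hx.1]

theorem mem_target_of_mem_coordDom {x₀ : M} {z : 𝔼} (hz : z ∈ coordDom n m V x₀) :
    z ∈ (ch x₀).target := by
  obtain ⟨x, hx, rfl⟩ := hz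
  exact (ch x₀).map_source hx.1

theorem chart_symm_of_mem_coordDom {x₀ : M} {z : 𝔼} (hz : z ∈ coordDom n m V x₀) :
    ch x₀ ((ch x₀).symm z) = z :=
  (ch x₀).right_inv (mem_target_of_mem_coordDom hz)

end

theorem contDiffOn_comp_chart_symm [IsManifold (𝓡 n) ∞ M] {F : Type*} [NormedAddCommGroup F]
    [NormedSpace ℝ F] {h : M → F} {U : Set M} (x₀ : M) (hU : U ⊆ (ch x₀).source)
    (hh : ContMDiffOn (𝓡 n) 𝓘(ℝ, F) ∞ h U) :
    ContDiffOn ℝ ∞ (fun z => h ((ch x₀).symm z)) (ch x₀ '' U) := by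
  rw [← contMDiffOn_iff_contDiffOn]
  refine hh.comp ((contMDiffOn_chart_symm (I := 𝓡 n) (x := x₀) (n := ∞)).mono ?_) ?_
  · rintro _ ⟨x, hx, rfl⟩
    exact (ch x₀).map_source (hU hx)
  · rintro _ ⟨x, hx, rfl⟩
    simpa [(ch x₀).left_inv (hU hx)] using hx

variable {V : M → Type*} [TopologicalSpace (Bundle.TotalSpace (Fin m → ℝ) V)]
  [∀ x, TopologicalSpace (V x)] [FiberBundle (Fin m → ℝ) V]

/-- The `i`-th component of a section, in adapted coordinates around `x₀`. -/
noncomputable def localComp (x₀ : M) (s : Sec n m V) (i : Fin m) : 𝔼 → ℝ :=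
  fun y => (trivializationAt (Fin m → ℝ) V x₀ ⟨(ch x₀).symm y, s ((ch x₀).symm y)⟩).2 i

/-- The fibre coordinates of order at most `k` of the jets of a section. -/
noncomputable def jetVec (k : ℕ) (x₀ : M) (s : Sec n m V) (z : 𝔼) : Fin m → multiIdx n k → ℝ :=
  fun i α => iterOps basePartial α (localComp x₀ s i) z

theorem exists_jet_eq (ρ : Jet n m V) : ∃ σ : Sec n m V, jet ρ.base σ = ρ := by
  obtain ⟨⟨x, σ⟩, rfl⟩ := Quotient.exists_rep ρ
  exact ⟨σ, rfl⟩

theorem jet_eq_jet_iff {x y : M} {σ τ : Sec n m V} : jet x σ = jet y τ ↔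
    x = y ∧ ∀ x₀, x ∈ adaptedDom n m V x₀ → ∀ i α,
      jetCoord n m V x₀ σ x i α = jetCoord n m V x₀ τ y i α :=
  Quotient.eq (r := jetSetoid n m V)

theorem coords_jet {x₀ x : M} (hx : x ∈ adaptedDom n m V x₀) (σ : Sec n m V) :
    (jet x σ).coords x₀ = (ch x₀ x, jetCoord n m V x₀ σ x) := by
  simp [jet, Jet.coords, hx]

theorem jetVec_eq_of_jet_eq (k : ℕ) {x₀ x : M} (hx : x ∈ adaptedDom n m V x₀) {σ τ : Sec n m V}
    (h : jet x σ = jet x τ) : jetVec k x₀ σ (ch x₀ x) = jetVec k x₀ τ (ch x₀ x) := by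
  funext i α
  exact (jet_eq_jet_iff.1 h).2 x₀ hx i α

/-- `f` is a smooth function of adapted coordinates of order at most `k`. -/
def IsOfOrder (k : ℕ) (f : M → Sec n m V → ℝ) : Prop :=
  ∀ x₀, ∃ g : 𝔼 × (Fin m → multiIdx n k → ℝ) → ℝ,
    ContDiffOn ℝ ∞ g (coordDom n m V x₀ ×ˢ Set.univ) ∧
    ∀ x ∈ adaptedDom n m V x₀, ∀ σ, f x σ = g (ch x₀ x, jetVec k x₀ σ (ch x₀ x))

theorem mem_jetFun_iff {f : Jet n m V → ℝ} :
    f ∈ JetFun n m V ↔ ∃ k, IsOfOrder k fun x (σ : Sec n m V) => f (jet x σ) := by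
  refine exists_congr fun k => forall_congr' fun x₀ => ⟨?_, ?_⟩
  · rintro ⟨G, ⟨g, hg, hG⟩, hf⟩
    refine ⟨g, hg, fun x hx σ => ?_⟩
    refine (hf (jet x σ) hx).trans ?_
    rw [hG _ (by rw [coords_jet hx]; exact ⟨x, hx, rfl⟩), coords_jet hx]
    rfl
  · rintro ⟨g, hg, hf⟩
    refine ⟨fun p => g (p.1, fun i α => p.2 i α), ⟨g, hg, fun _ _ => rfl⟩, fun ρ hρ => ?_⟩
    obtain ⟨⟨x, σ⟩, rfl⟩ := Quotient.exists_rep ρ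
    change f (jet x σ) = g (((jet x σ).coords x₀).1, fun i α => ((jet x σ).coords x₀).2 i α)
    rw [coords_jet (x := x) hρ]
    exact hf x hρ σ

/-- Restriction of the fibre coordinates to a smaller order. -/
def truncate {k k' : ℕ} (h : k ≤ k') (u : Fin m → multiIdx n k' → ℝ) :
    Fin m → multiIdx n k → ℝ := fun i α => u i ⟨α, multiIdx_mono h α.2⟩

theorem truncate_jetVec {k k' : ℕ} (h : k ≤ k') (x₀ : M) (s : Sec n m V) (z : 𝔼) :
    truncate h (jetVec k' x₀ s z) = jetVec k x₀ s z := rfl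

theorem IsOfOrder.mono {k k' : ℕ} (h : k ≤ k') {f : M → Sec n m V → ℝ} (hf : IsOfOrder k f) :
    IsOfOrder k' f := by
  intro x₀
  obtain ⟨g, hg, hfg⟩ := hf x₀
  refine ⟨fun p => g (p.1, truncate h p.2), hg.comp (ContDiff.contDiffOn ?_) fun p hp =>
    ⟨hp.1, trivial⟩, hfg⟩
  unfold truncate
  fun_prop

theorem IsOfOrder.eq_of_jet_eq {k : ℕ} {f : M → Sec n m V → ℝ} (hf : IsOfOrder k f) {x : M}
    {σ τ : Sec n m V} (h : jet x σ = jet x τ) : f x σ = f x τ := by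
  obtain ⟨g, _, hfg⟩ := hf x
  rw [hfg x (mem_adaptedDom_self V x), hfg x (mem_adaptedDom_self V x),
    jetVec_eq_of_jet_eq k (mem_adaptedDom_self V x) h]

/-- The function on the jet space that is given by `f` on the jets of sections. -/
noncomputable def descend (f : M → Sec n m V → ℝ) : Jet n m V → ℝ :=
  fun ρ => f ρ.base (exists_jet_eq ρ).choose

theorem descend_jet {k : ℕ} {f : M → Sec n m V → ℝ} (hf : IsOfOrder k f) (x : M)
    (σ : Sec n m V) : descend f (jet x σ) = f x σ :=
  hf.eq_of_jet_eq (exists_jet_eq (jet x σ)).choose_spec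

theorem descend_mem_jetFun {k : ℕ} {f : M → Sec n m V → ℝ} (hf : IsOfOrder k f) :
    descend f ∈ JetFun n m V :=
  mem_jetFun_iff.2 ⟨k, by simpa only [descend_jet hf] using hf⟩

/-- Evaluation at a jet. -/
def evalAt (ρ : Jet n m V) : JetFun n m V →+* ℝ :=
  (Pi.evalRingHom (fun _ => ℝ) ρ).comp (JetFun n m V).val.toRingHom

theorem evalAt_apply (ρ : Jet n m V) (f : JetFun n m V) : evalAt ρ f = f.1 ρ := rfl

theorem jetFun_ext {f g : JetFun n m V} (h : ∀ x (σ : Sec n m V), f.1 (jet x σ) = g.1 (jet x σ)) :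
    f = g := by
  refine Subtype.ext (funext fun ρ => ?_)
  obtain ⟨σ, hσ⟩ := exists_jet_eq ρ
  rw [← hσ]
  exact h _ σ

/-- The vector field given at the jet of each section by a derivation. -/
noncomputable def fieldOf (δ : JetFun n m V → M → Sec n m V → ℝ)
    (hδ : ∀ f, ∃ k, IsOfOrder k (δ f))
    (hadd : ∀ f g x σ, δ (f + g) x σ = δ f x σ + δ g x σ)
    (hsmul : ∀ (c : ℝ) f x σ, δ (c • f) x σ = c * δ f x σ)
    (hmul : ∀ f g x σ, δ (f * g) x σ = f.1 (jet x σ) * δ g x σ + g.1 (jet x σ) * δ f x σ) :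
    JetField n m V :=
  Derivation.mk'
    { toFun := fun f => ⟨descend (δ f), (hδ f).elim fun _ h => descend_mem_jetFun h⟩
      map_add' := fun f g => jetFun_ext fun x σ => by
        obtain ⟨_, h1⟩ := hδ (f + g)
        obtain ⟨_, h2⟩ := hδ f
        obtain ⟨_, h3⟩ := hδ g
        change descend _ _ = descend _ _ + descend _ _
        rw [descend_jet h1, descend_jet h2, descend_jet h3, hadd]
      map_smul' := fun c f => jetFun_ext fun x σ => by
        obtain ⟨_, h1⟩ := hδ (c • f)
        obtain ⟨_, h2⟩ := hδ f
        change descend _ _ = c * descend _ _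
        rw [descend_jet h1, descend_jet h2, hsmul] }
    (fun f g => jetFun_ext fun x σ => by
      obtain ⟨_, h1⟩ := hδ (f * g)
      obtain ⟨_, h2⟩ := hδ f
      obtain ⟨_, h3⟩ := hδ g
      change descend _ _ = f.1 _ * descend _ _ + g.1 _ * descend _ _
      rw [descend_jet h1, descend_jet h2, descend_jet h3, hmul])

theorem fieldOf_apply (δ : JetFun n m V → M → Sec n m V → ℝ) (hδ hadd hsmul hmul)
    (f : JetFun n m V) (x : M) (σ : Sec n m V) :
    (fieldOf δ hδ hadd hsmul hmul f).1 (jet x σ) = δ f x σ :=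
  (hδ f).elim fun _ h => descend_jet h x σ

theorem isOfOrder_base [IsManifold (𝓡 n) ∞ M] {h : M → ℝ} (hh : ContMDiff (𝓡 n) 𝓘(ℝ, ℝ) ∞ h) :
    IsOfOrder 0 fun x (_ : Sec n m V) => h x := by
  intro x₀
  refine ⟨fun p => h ((ch x₀).symm p.1),
    (contDiffOn_comp_chart_symm x₀ (adaptedDom_subset_source V x₀) hh.contMDiffOn).comp
      contDiffOn_fst fun p hp => hp.1, fun x hx σ => ?_⟩
  simp only [(ch x₀).left_inv hx.1]

theorem smoothComp_mem_jetFun {ι : Type*} [Fintype ι] {H : (ι → ℝ) → ℝ} (hH : ContDiff ℝ ∞ H)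
    (g : ι → JetFun n m V) : (fun ρ => H fun i => (g i).1 ρ) ∈ JetFun n m V := by
  choose k hk using fun i => mem_jetFun_iff.1 (g i).2
  have hk' := fun i => (hk i).mono (Finset.le_sup (f := k) (Finset.mem_univ i))
  refine mem_jetFun_iff.2 ⟨Finset.univ.sup k, fun x₀ => ?_⟩
  choose G hG hgG using fun i => hk' i x₀
  exact ⟨fun p => H fun i => G i p, hH.comp_contDiffOn (contDiffOn_pi.2 hG), fun x hx σ => by
    simp only [hgG _ x hx]⟩

/-- The composition `H(g₁, …, g_N)` of functions on the jet space with a smooth function of `N`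
variables: it makes `𝓕(π)` closed under smooth, not only polynomial, operations. -/
def smoothComp {ι : Type*} [Fintype ι] {H : (ι → ℝ) → ℝ} (hH : ContDiff ℝ ∞ H)
    (g : ι → JetFun n m V) : JetFun n m V := ⟨_, smoothComp_mem_jetFun hH g⟩

theorem smoothComp_apply {ι : Type*} [Fintype ι] {H : (ι → ℝ) → ℝ} (hH : ContDiff ℝ ∞ H)
    (g : ι → JetFun n m V) (ρ : Jet n m V) : (smoothComp hH g).1 ρ = H fun i => (g i).1 ρ := rfl

-- By Hadamard's lemma, as the Leibniz rule alone gives the chain rule only for polynomials.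
theorem exists_chain_rule {ι : Type*} [Fintype ι] {H : (ι → ℝ) → ℝ} (hH : ContDiff ℝ ∞ H)
    (g : ι → JetFun n m V) (ρ : Jet n m V) : ∃ c : ι → ℝ, ∀ X : JetField n m V,
      (X (smoothComp hH g)).1 ρ = ∑ i, c i * (X (g i)).1 ρ := by
  obtain ⟨h, hh, hH'⟩ := exists_hadamard hH fun i => (g i).1 ρ
  refine ⟨fun i => h i fun i => (g i).1 ρ, fun X => ?_⟩
  have hdecomp : smoothComp hH g = algebraMap ℝ (JetFun n m V) (H fun i => (g i).1 ρ) +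
      ∑ i, (g i - algebraMap ℝ (JetFun n m V) ((g i).1 ρ)) * smoothComp (hh i) g := by
    refine Subtype.ext (funext fun ρ' => ?_)
    rw [← evalAt_apply ρ', ← evalAt_apply ρ', map_add, map_sum]
    simp only [map_mul, map_sub]
    exact hH' _
  have hvanish : ∀ i, evalAt ρ (g i - algebraMap ℝ (JetFun n m V) ((g i).1 ρ)) = 0 :=
    fun i => sub_self _
  rw [hdecomp, map_add, X.map_algebraMap, zero_add, map_sum, ← evalAt_apply, map_sum]
  refine Finset.sum_congr rfl fun i _ => ?_
  rw [Derivation.leibniz, smul_eq_mul, smul_eq_mul, map_add, map_mul, map_mul, hvanish, zero_mul,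
    zero_add, map_sub, X.map_algebraMap, sub_zero, evalAt_apply, evalAt_apply, smoothComp_apply]

end JetFunctions

section TranslationFields

variable {n m : ℕ} {M : Type*} [TopologicalSpace M] [ChartedSpace (EuclideanSpace ℝ (Fin n)) M]
  {V : M → Type*} [TopologicalSpace (Bundle.TotalSpace (Fin m → ℝ) V)]
  [∀ x, TopologicalSpace (V x)] [FiberBundle (Fin m → ℝ) V]

local notation "𝔼" => EuclideanSpace ℝ (Fin n)
local notation "ch" => chartAt (EuclideanSpace ℝ (Fin n))

theorem localComp_chart {x₀ x : M} (hx : x ∈ adaptedDom n m V x₀) (σ : Sec n m V) (i : Fin m) :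
    localComp x₀ σ i (ch x₀ x) = (trivializationAt (Fin m → ℝ) V x₀ ⟨x, σ x⟩).2 i := by
  unfold localComp
  rw [(ch x₀).left_inv hx.1]

theorem isOpen_coordDom_prod_univ (x₀ : M) (k : ℕ) :
    IsOpen (coordDom n m V x₀ ×ˢ (Set.univ : Set (Fin m → multiIdx n k → ℝ))) :=
  (isOpen_coordDom V x₀).prod isOpen_univ

theorem exists_local_expression (f : JetFun n m V) : ∃ k, ∀ x₀,
    ∃ g : 𝔼 × (Fin m → multiIdx n k → ℝ) → ℝ,
      ContDiffOn ℝ ∞ g (coordDom n m V x₀ ×ˢ Set.univ) ∧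
      ∀ z ∈ coordDom n m V x₀, ∀ σ, f.1 (jet ((ch x₀).symm z) σ) = g (z, jetVec k x₀ σ z) := by
  obtain ⟨k, hk⟩ := mem_jetFun_iff.1 f.2
  refine ⟨k, fun x₀ => ?_⟩
  obtain ⟨g, hg, h⟩ := hk x₀
  refine ⟨g, hg, fun z hz σ => ?_⟩
  simpa only [chart_symm_of_mem_coordDom hz] using h _ (symm_mem_adaptedDom hz) σ

theorem add_single_mem_multiIdx {k : ℕ} {α : Fin n → ℕ} (hα : α ∈ multiIdx n k) (j : Fin n) :
    α + Pi.single j 1 ∈ multiIdx n (k + 1) := by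
  have hle : ∀ i, (Pi.single j 1 : Fin n → ℕ) i ≤ 1 := fun i => by
    by_cases h : i = j <;> simp [h]
  simp only [multiIdx, Finset.mem_filter, Fintype.mem_piFinset, Finset.mem_range, Pi.add_apply,
    Finset.sum_add_distrib, Finset.sum_pi_single', Finset.mem_univ, if_true] at hα ⊢
  exact ⟨fun i => by have := hα.1 i; have := hle i; omega, by have := hα.2; omega⟩

/-- The fibre components `∑ⱼ wʲ uⁱ_{α + xʲ}` of the total derivative in the direction `w`; they
involve the coordinates of one order more. -/
def shift {k : ℕ} (w : 𝔼) (u : Fin m → multiIdx n (k + 1) → ℝ) : Fin m → multiIdx n k → ℝ :=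
  fun i α => ∑ j, w j * u i ⟨α.1 + Pi.single j 1, add_single_mem_multiIdx α.2 j⟩

variable [∀ x, AddCommGroup (V x)] [∀ x, Module ℝ (V x)] [VectorBundle ℝ (Fin m → ℝ) V]

theorem localComp_add_smul (x₀ : M) (σ τ : Sec n m V) (ε : ℝ) (i : Fin m) :
    Set.EqOn (localComp x₀ (σ + ε • τ) i) (localComp x₀ σ i + ε • localComp x₀ τ i)
      (coordDom n m V x₀) := by
  intro z hz
  have hlin := (trivializationAt (Fin m → ℝ) V x₀).linear ℝ (symm_mem_adaptedDom hz).2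
  have hadd := congrFun (hlin.map_add (σ ((ch x₀).symm z)) (ε • τ ((ch x₀).symm z))) i
  rw [Pi.add_apply, hlin.map_smul] at hadd
  exact hadd

variable [IsManifold (𝓡 n) ∞ M] [ContMDiffVectorBundle ∞ (Fin m → ℝ) V (𝓡 n)]

theorem contDiffOn_localComp (x₀ : M) (σ : Sec n m V) (i : Fin m) :
    ContDiffOn ℝ ∞ (localComp x₀ σ i) (coordDom n m V x₀) := by
  have h := ((trivializationAt (Fin m → ℝ) V x₀).contMDiffOn_section_baseSet_iff
    (IB := 𝓡 n) (n := ∞) (s := σ)).1 σ.contMDiff.contMDiffOn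
  exact contDiffOn_pi.1 (contDiffOn_comp_chart_symm x₀ (adaptedDom_subset_source V x₀)
    (h.mono Set.inter_subset_right)) i

theorem contDiffOn_jetVec (k : ℕ) (x₀ : M) (σ : Sec n m V) :
    ContDiffOn ℝ ∞ (jetVec k x₀ σ) (coordDom n m V x₀) :=
  contDiffOn_pi.2 fun i => contDiffOn_pi.2 fun α =>
    contDiffOn_iterOps_basePartial (isOpen_coordDom V x₀) (contDiffOn_localComp x₀ σ i) α

theorem iterOps_basePartial_localComp_add_smul (x₀ : M) (σ τ : Sec n m V) (ε : ℝ) (i : Fin m)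
    (α : Fin n → ℕ) : Set.EqOn (iterOps basePartial α (localComp x₀ (σ + ε • τ) i))
      (iterOps basePartial α (localComp x₀ σ i) + ε • iterOps basePartial α (localComp x₀ τ i))
      (coordDom n m V x₀) :=
  have hO := isOpen_coordDom (n := n) (m := m) V x₀
  (iterOps_basePartial_congr hO (localComp_add_smul x₀ σ τ ε i) α).trans
    (iterOps_basePartial_add_smul hO (contDiffOn_localComp x₀ σ i) (contDiffOn_localComp x₀ τ i)
      ε α)

theorem jetVec_add_smul (k : ℕ) {x₀ : M} (σ τ : Sec n m V) (ε : ℝ) {z : 𝔼}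
    (hz : z ∈ coordDom n m V x₀) :
    jetVec k x₀ (σ + ε • τ) z = jetVec k x₀ σ z + ε • jetVec k x₀ τ z :=
  funext₂ fun i α => iterOps_basePartial_localComp_add_smul x₀ σ τ ε i α hz

theorem fderiv_jetVec (k : ℕ) {x₀ : M} (σ : Sec n m V) {z : 𝔼} (hz : z ∈ coordDom n m V x₀)
    (w : 𝔼) : fderiv ℝ (jetVec k x₀ σ) z w = shift w (jetVec (k + 1) x₀ σ z) := by
  have hO := isOpen_coordDom (n := n) (m := m) V x₀
  have hw : w = ∑ j, w j • EuclideanSpace.single j (1 : ℝ) := by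
    ext i
    simp [Finset.sum_apply, Pi.single_apply]
  have hd := fun i (α : multiIdx n k) =>
    contDiffOn_iterOps_basePartial hO (contDiffOn_localComp x₀ σ i) α.1
  have hfd : HasFDerivAt (jetVec k x₀ σ) (ContinuousLinearMap.pi fun i =>
      ContinuousLinearMap.pi fun α : multiIdx n k =>
        fderiv ℝ (iterOps basePartial α.1 (localComp x₀ σ i)) z) z :=
    hasFDerivAt_pi.2 fun i => hasFDerivAt_pi.2 fun α =>
      (((hd i α).contDiffAt (hO.mem_nhds hz)).differentiableAt (by simp)).hasFDerivAt
  rw [hfd.fderiv]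
  funext i α
  change fderiv ℝ (iterOps basePartial α.1 (localComp x₀ σ i)) z w = _
  conv_lhs => rw [hw, map_sum]
  refine Finset.sum_congr rfl fun j _ => ?_
  rw [map_smul, smul_eq_mul, ← basePartial_eq_fderiv hO (hd i α) hz,
    ← iterOps_basePartial_add_single hO (contDiffOn_localComp x₀ σ i) α j hz]
  rfl

theorem contDiffOn_comp_jet_add_smul (f : JetFun n m V) (x₀ : M) (σ τ : Sec n m V) :
    ContDiffOn ℝ ∞ (fun q : ℝ × 𝔼 => f.1 (jet ((ch x₀).symm q.2) (σ + q.1 • τ)))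
      (Set.univ ×ˢ coordDom n m V x₀) := by
  obtain ⟨k, hk⟩ := exists_local_expression f
  obtain ⟨g, hg, h⟩ := hk x₀
  have hjet : ∀ σ : Sec n m V, ContDiffOn ℝ ∞ (fun q : ℝ × 𝔼 => jetVec k x₀ σ q.2)
      (Set.univ ×ˢ coordDom n m V x₀) := fun σ =>
    (contDiffOn_jetVec k x₀ σ).comp contDiffOn_snd fun q hq => hq.2
  refine (hg.comp (contDiffOn_snd.prodMk ((hjet σ).add (contDiffOn_fst.smul (hjet τ))))
    fun q hq => ⟨hq.2, trivial⟩).congr fun q hq => ?_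
  rw [h _ hq.2, jetVec_add_smul k σ τ q.1 hq.2]
  rfl

theorem contDiffOn_comp_jet (f : JetFun n m V) (x₀ : M) (σ : Sec n m V) :
    ContDiffOn ℝ ∞ (fun z => f.1 (jet ((ch x₀).symm z) σ)) (coordDom n m V x₀) := by
  obtain ⟨k, hk⟩ := exists_local_expression f
  obtain ⟨g, hg, h⟩ := hk x₀
  exact (hg.comp (contDiffOn_id.prodMk (contDiffOn_jetVec k x₀ σ)) fun q hq => ⟨hq, trivial⟩).congr
    fun q hq => h q hq σ

theorem contMDiff_comp_jet (f : JetFun n m V) (σ : Sec n m V) :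
    ContMDiff (𝓡 n) 𝓘(ℝ, ℝ) ∞ fun y => f.1 (jet y σ) := by
  intro x
  have h := (contMDiffOn_iff_contDiffOn.2 (contDiffOn_comp_jet f x σ)).comp
    ((contMDiffOn_chart (I := 𝓡 n) (x := x) (n := ∞)).mono (adaptedDom_subset_source V x))
    fun y hy => chart_mem_coordDom hy
  refine ((h.congr fun y hy => ?_).contMDiffAt
    ((isOpen_adaptedDom V x).mem_nhds (mem_adaptedDom_self V x)))
  simp only [Function.comp, (ch x).left_inv hy.1]

theorem differentiable_comp_jet_add_smul (f : JetFun n m V) (x : M) (σ τ : Sec n m V) :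
    Differentiable ℝ fun ε : ℝ => f.1 (jet x (σ + ε • τ)) := by
  have h := (contDiffOn_comp_jet_add_smul f x σ τ).comp (s := Set.univ)
    (f := fun ε : ℝ => (ε, ch x x)) (by fun_prop)
    fun ε _ => ⟨trivial, chart_mem_coordDom (mem_adaptedDom_self V x)⟩
  simp only [Function.comp_def, (ch x).left_inv (mem_chart_source _ x)] at h
  exact (contDiffOn_univ.1 h).differentiable (by simp)

theorem isOfOrder_deriv_add_smul (τ : Sec n m V) (f : JetFun n m V) :
    ∃ k, IsOfOrder k fun x (σ : Sec n m V) => deriv (fun ε : ℝ => f.1 (jet x (σ + ε • τ))) 0 := by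
  obtain ⟨k, hk⟩ := exists_local_expression f
  refine ⟨k, fun x₀ => ?_⟩
  obtain ⟨g, hg, h⟩ := hk x₀
  have hO := isOpen_coordDom_prod_univ (n := n) (m := m) (V := V) x₀ k
  refine ⟨fun p => fderiv ℝ g p (0, jetVec k x₀ τ p.1), (hg.fderiv_of_isOpen hO (by simp)).clm_apply
    (contDiffOn_const.prodMk ((contDiffOn_jetVec k x₀ τ).comp contDiffOn_fst fun p hp => hp.1)),
    fun x hx σ => ?_⟩
  have hz := chart_mem_coordDom hx
  have hline : ∀ ε : ℝ, f.1 (jet x (σ + ε • τ)) =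
      g ((ch x₀ x, jetVec k x₀ σ (ch x₀ x)) + ε • (0, jetVec k x₀ τ (ch x₀ x))) := fun ε => by
    rw [Prod.smul_mk, Prod.mk_add_mk, smul_zero, add_zero, ← jetVec_add_smul k σ τ ε hz, ← h _ hz,
      (ch x₀).left_inv hx.1]
  simp only [hline]
  exact lineDeriv_eq_fderiv_of_contDiffOn hO hg ⟨hz, trivial⟩ _

/-- The evolutionary field whose generating section is the pullback of the section `τ` of the
bundle: its flow translates each section by the multiples of `τ`. -/
noncomputable def translationField (τ : Sec n m V) : JetField n m V :=
  fieldOf (fun f x σ => deriv (fun ε : ℝ => f.1 (jet x (σ + ε • τ))) 0)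
    (isOfOrder_deriv_add_smul τ)
    (fun f g x σ => by
      exact deriv_fun_add (differentiable_comp_jet_add_smul f x σ τ 0)
        (differentiable_comp_jet_add_smul g x σ τ 0))
    (fun c f x σ => by
      exact deriv_const_mul c (differentiable_comp_jet_add_smul f x σ τ 0))
    (fun f g x σ => by
      have h := deriv_fun_mul (differentiable_comp_jet_add_smul f x σ τ 0)
        (differentiable_comp_jet_add_smul g x σ τ 0)
      simp only [zero_smul, add_zero] at h
      exact h.trans (by ring))

theorem translationField_apply (τ : Sec n m V) (f : JetFun n m V) (x : M) (σ : Sec n m V) :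
    (translationField τ f).1 (jet x σ) = deriv (fun ε : ℝ => f.1 (jet x (σ + ε • τ))) 0 :=
  fieldOf_apply _ _ _ _ _ f x σ

theorem isVerticalAt_translationField (τ : Sec n m V) (ρ : Jet n m V) :
    IsVerticalAt (translationField τ) ρ := by
  intro f hf
  obtain ⟨σ, hσ⟩ := exists_jet_eq ρ
  have hconst : ∀ ε : ℝ, f.1 (jet ρ.base (σ + ε • τ)) = f.1 (jet ρ.base σ) := fun _ => hf _ _ rfl
  rw [← hσ, translationField_apply, funext hconst, deriv_const]

/-- The element of `ϰ(π)` that is the pullback of a section of the bundle. -/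
noncomputable def pullbackSection (τ : Sec n m V) : JetSection n m V m V where
  val ρ := τ ρ.base
  smooth := by
    refine ⟨0, fun x₀ i => ⟨fun p => localComp x₀ τ i p.1, ⟨fun p => localComp x₀ τ i p.1,
      (contDiffOn_localComp x₀ τ i).comp contDiffOn_fst fun p hp =>
        Set.image_mono Set.inter_subset_left hp.1, fun _ _ => rfl⟩, fun ρ hρ => ?_⟩⟩
    obtain ⟨σ, hσ⟩ := exists_jet_eq ρ
    have hbase : (ρ.coords x₀).1 = ch x₀ ρ.base := by
      conv_lhs => rw [← hσ, coords_jet hρ.1]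
    change _ = localComp x₀ τ i (ρ.coords x₀).1
    rw [hbase, localComp_chart hρ.1]

theorem isEvolutionary_translationField (τ : Sec n m V) :
    IsEvolutionary (pullbackSection τ) (translationField τ) := fun σ =>
  ⟨τ, fun _ => rfl, fun x f => translationField_apply τ f x σ⟩

end TranslationFields

section CartanFields

variable {n m : ℕ} {M : Type*} [TopologicalSpace M] [ChartedSpace (EuclideanSpace ℝ (Fin n)) M]
  [IsManifold (𝓡 n) ∞ M]

local notation "𝔼" => EuclideanSpace ℝ (Fin n)
local notation "ch" => chartAt (EuclideanSpace ℝ (Fin n))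

variable (n M) in
/-- Smooth vector fields on the base. -/
abbrev VecField : Type _ := ContMDiffSection (𝓡 n) 𝔼 ∞ (TangentSpace (𝓡 n) : M → Type _)

/-- The components of a tangent vector in the chart around `x₀`. -/
noncomputable def vecComp (x₀ : M) {y : M} (w : TangentSpace (𝓡 n) y) : 𝔼 :=
  (trivializationAt 𝔼 (TangentSpace (𝓡 n)) x₀ ⟨y, w⟩).2

theorem contDiffOn_vecComp (x₀ : M) (W : VecField n M) :
    ContDiffOn ℝ ∞ (fun z => vecComp x₀ (W ((ch x₀).symm z))) (ch x₀).target := by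
  rw [← (ch x₀).image_source_eq_target]
  exact contDiffOn_comp_chart_symm (F := 𝔼) x₀ subset_rfl
    (((trivializationAt 𝔼 (TangentSpace (𝓡 n)) x₀).contMDiffOn_section_baseSet_iff
      (IB := 𝓡 n) (n := ∞) (s := W)).1 W.contMDiff.contMDiffOn)

theorem vecComp_eq_mfderiv {x₀ y : M} (hy : y ∈ (ch x₀).source) (w : TangentSpace (𝓡 n) y) :
    vecComp x₀ w = mfderiv (𝓡 n) (𝓡 n) (ch x₀) y w := by
  have h := congrArg (fun L : 𝔼 →L[ℝ] 𝔼 => L w)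
    (TangentBundle.continuousLinearMapAt_trivializationAt (I := 𝓡 n) hy)
  exact (congrFun ((trivializationAt 𝔼 (TangentSpace (𝓡 n)) x₀).coe_linearMapAt_of_mem hy)
    w).symm.trans h

theorem mfderiv_apply_eq_fderiv_vecComp {h : M → ℝ} {x₀ y : M} (hy : y ∈ (ch x₀).source)
    (hh : MDifferentiableAt (𝓡 n) 𝓘(ℝ, ℝ) h y) (w : TangentSpace (𝓡 n) y) :
    mfderiv (𝓡 n) 𝓘(ℝ, ℝ) h y w = fderiv ℝ (h ∘ (ch x₀).symm) (ch x₀ y) (vecComp x₀ w) := by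
  have hcongr : h =ᶠ[nhds y] (h ∘ (ch x₀).symm) ∘ ch x₀ := by
    filter_upwards [(ch x₀).open_source.mem_nhds hy] with q hq
    simp only [Function.comp, (ch x₀).left_inv hq]
  have hsymm : MDifferentiableAt (𝓡 n) (𝓡 n) (ch x₀).symm (ch x₀ y) :=
    mdifferentiableAt_atlas_symm (chart_mem_atlas _ x₀) ((ch x₀).map_source hy)
  have hd : MDifferentiableAt (𝓡 n) 𝓘(ℝ, ℝ) (h ∘ (ch x₀).symm) (ch x₀ y) :=
    MDifferentiableAt.comp (I' := 𝓡 n) _ (by rwa [(ch x₀).left_inv hy]) hsymm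
  rw [hcongr.mfderiv_eq, mfderiv_comp y hd (mdifferentiableAt_atlas (chart_mem_atlas _ x₀) hy),
    vecComp_eq_mfderiv hy, mfderiv_eq_fderiv]
  rfl

variable {V : M → Type*} [TopologicalSpace (Bundle.TotalSpace (Fin m → ℝ) V)]
  [∀ x, TopologicalSpace (V x)] [FiberBundle (Fin m → ℝ) V] [∀ x, AddCommGroup (V x)]
  [∀ x, Module ℝ (V x)] [VectorBundle ℝ (Fin m → ℝ) V] [ContMDiffVectorBundle ∞ (Fin m → ℝ) V (𝓡 n)]

theorem mdifferentiableAt_comp_jet (f : JetFun n m V) (y : M) (σ : Sec n m V) :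
    MDifferentiableAt (𝓡 n) 𝓘(ℝ, ℝ) (fun y => f.1 (jet y σ)) y :=
  (contMDiff_comp_jet f σ).mdifferentiableAt (by simp)

theorem fderiv_comp_jetVec {k : ℕ} {x₀ : M} {g : 𝔼 × (Fin m → multiIdx n k → ℝ) → ℝ}
    (hg : ContDiffOn ℝ ∞ g (coordDom n m V x₀ ×ˢ Set.univ)) (σ : Sec n m V) {z : 𝔼}
    (hz : z ∈ coordDom n m V x₀) (w : 𝔼) :
    fderiv ℝ (fun z => g (z, jetVec k x₀ σ z)) z w =
      fderiv ℝ g (z, jetVec k x₀ σ z) (w, shift w (jetVec (k + 1) x₀ σ z)) := by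
  have hgd := (hg.contDiffAt ((isOpen_coordDom_prod_univ x₀ k).mem_nhds
    (x := (z, jetVec k x₀ σ z)) ⟨hz, trivial⟩)).differentiableAt (by simp)
  have hjd := ((contDiffOn_jetVec k x₀ σ).contDiffAt
    ((isOpen_coordDom V x₀).mem_nhds hz)).differentiableAt (by simp)
  rw [← fderiv_jetVec k σ hz]
  exact congrArg (· w)
    (hgd.hasFDerivAt.comp z ((hasFDerivAt_id z).prodMk hjd.hasFDerivAt)).fderiv

theorem isOfOrder_mfderiv_comp_jet (W : VecField n M) (f : JetFun n m V) :
    ∃ k, IsOfOrder k fun y (σ : Sec n m V) =>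
      mfderiv (𝓡 n) 𝓘(ℝ, ℝ) (fun y => f.1 (jet y σ)) y (W y) := by
  obtain ⟨k, hk⟩ := exists_local_expression f
  refine ⟨k + 1, fun x₀ => ?_⟩
  obtain ⟨g, hg, h⟩ := hk x₀
  let w (z : 𝔼) : 𝔼 := vecComp x₀ (W ((ch x₀).symm z))
  have hw : ContDiffOn ℝ ∞ (fun p : 𝔼 × (Fin m → multiIdx n (k + 1) → ℝ) => w p.1)
      (coordDom n m V x₀ ×ˢ Set.univ) :=
    (contDiffOn_vecComp x₀ W).comp contDiffOn_fst fun p hp => mem_target_of_mem_coordDom hp.1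
  refine ⟨fun p => fderiv ℝ g (p.1, truncate k.le_succ p.2) (w p.1, shift (w p.1) p.2), ?_,
    fun y hy σ => ?_⟩
  · refine ((hg.fderiv_of_isOpen (isOpen_coordDom_prod_univ x₀ k) (m := ∞) (by simp)).comp
      (ContDiff.contDiffOn ?_) fun p hp => ⟨hp.1, trivial⟩).clm_apply (hw.prodMk ?_)
    · unfold truncate
      fun_prop
    · exact contDiffOn_pi.2 fun i => contDiffOn_pi.2 fun α => ContDiffOn.sum fun j _ =>
        ((contDiff_piLp_apply 2).comp_contDiffOn hw).mul (ContDiff.contDiffOn (by fun_prop))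
  · have hcongr : (fun y => f.1 (jet y σ)) ∘ (ch x₀).symm =ᶠ[nhds (ch x₀ y)]
        fun z => g (z, jetVec k x₀ σ z) := by
      filter_upwards [(isOpen_coordDom V x₀).mem_nhds (chart_mem_coordDom hy)] with z hz
      exact h z hz σ
    refine (mfderiv_apply_eq_fderiv_vecComp hy.1 (mdifferentiableAt_comp_jet f y σ) _).trans ?_
    rw [hcongr.fderiv_eq, fderiv_comp_jetVec hg σ (chart_mem_coordDom hy)]
    have hwy : w (ch x₀ y) = vecComp x₀ (W y) :=
      congrArg (fun q => vecComp x₀ (W q)) ((ch x₀).left_inv hy.1)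
    simp only [truncate_jetVec, hwy]
    rfl

/-- The lift of a vector field of the base to the Cartan distribution: the total derivative in the
direction of `W`. -/
noncomputable def cartanLift (W : VecField n M) : JetField n m V :=
  fieldOf (fun f y σ => mfderiv (𝓡 n) 𝓘(ℝ, ℝ) (fun y => f.1 (jet y σ)) y (W y))
    (isOfOrder_mfderiv_comp_jet W)
    (fun f g y σ => congrArg (fun L : 𝔼 →L[ℝ] ℝ => L (W y)) (mfderiv_add
      (mdifferentiableAt_comp_jet f y σ) (mdifferentiableAt_comp_jet g y σ)))
    (fun c f y σ => congrArg (fun L : 𝔼 →L[ℝ] ℝ => L (W y))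
      (const_smul_mfderiv (mdifferentiableAt_comp_jet f y σ) c))
    (fun f g y σ => congrArg (fun L : 𝔼 →L[ℝ] ℝ => L (W y))
      ((mdifferentiableAt_comp_jet f y σ).hasMFDerivAt.mul
        (mdifferentiableAt_comp_jet g y σ).hasMFDerivAt).mfderiv)

theorem cartanLift_apply (W : VecField n M) (f : JetFun n m V) (y : M) (σ : Sec n m V) :
    (cartanLift W f).1 (jet y σ) = mfderiv (𝓡 n) 𝓘(ℝ, ℝ) (fun y => f.1 (jet y σ)) y (W y) :=
  fieldOf_apply _ _ _ _ _ f y σ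

theorem isLiftAt_cartanLift (W : VecField n M) (ρ : Jet n m V) :
    IsLiftAt (cartanLift W) ρ (W ρ.base) := by
  rintro x σ rfl f
  exact cartanLift_apply W f x σ

theorem isCartanAt_cartanLift (W : VecField n M) (ρ : Jet n m V) : IsCartanAt (cartanLift W) ρ :=
  ⟨_, isLiftAt_cartanLift W ρ⟩

theorem cartanLift_apply_eq_fderiv {x₀ y : M} (hy : y ∈ (ch x₀).source) (W : VecField n M)
    (f : JetFun n m V) (σ : Sec n m V) : (cartanLift W f).1 (jet y σ) =
      fderiv ℝ (fun z => f.1 (jet ((ch x₀).symm z) σ)) (ch x₀ y) (vecComp x₀ (W y)) :=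
  (cartanLift_apply W f y σ).trans
    (mfderiv_apply_eq_fderiv_vecComp hy (mdifferentiableAt_comp_jet f y σ) (W y))

theorem lie_translationField_cartanLift (τ : Sec n m V) (W : VecField n M) :
    ⁅translationField τ, (cartanLift W : JetField n m V)⁆ = 0 := by
  refine Derivation.ext fun f => jetFun_ext fun y σ => ?_
  rw [Derivation.commutator_apply]
  change (translationField τ (cartanLift W f)).1 (jet y σ) -
    (cartanLift W (translationField τ f)).1 (jet y σ) = 0
  have hy := mem_chart_source 𝔼 y
  rw [translationField_apply, cartanLift_apply_eq_fderiv hy, sub_eq_zero]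
  simp only [cartanLift_apply_eq_fderiv (V := V) (m := m) hy, translationField_apply]
  exact deriv_fderiv_comm (isOpen_coordDom V y) (contDiffOn_comp_jet_add_smul f y σ τ) 0
    (chart_mem_coordDom (n := n) (m := m) (mem_adaptedDom_self V y)) _

end CartanFields

section Germs

variable {n m : ℕ} {M : Type*} [TopologicalSpace M] [ChartedSpace (EuclideanSpace ℝ (Fin n)) M]

local notation "𝔼" => EuclideanSpace ℝ (Fin n)
local notation "ch" => chartAt (EuclideanSpace ℝ (Fin n))

theorem contMDiffOn_smul_of_tsupport {G : Type*} [NormedAddCommGroup G] [NormedSpace ℝ G]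
    {χ : M → ℝ} (hχ : ContMDiff (𝓡 n) 𝓘(ℝ, ℝ) ∞ χ) {U W : Set M} (hU : IsOpen U) (hW : IsOpen W)
    (hs : tsupport χ ⊆ W) {h : M → G} (hh : ContMDiffOn (𝓡 n) 𝓘(ℝ, G) ∞ h (U ∩ W)) :
    ContMDiffOn (𝓡 n) 𝓘(ℝ, G) ∞ (fun y => χ y • h y) U := by
  intro y hy
  refine ContMDiffAt.contMDiffWithinAt ?_
  by_cases hyt : y ∈ tsupport χ
  · exact hχ.contMDiffAt.smul (hh.contMDiffAt ((hU.inter hW).mem_nhds ⟨hy, hs hyt⟩))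
  · refine (contMDiffAt_const (c := (0 : G))).congr_of_eventuallyEq ?_
    filter_upwards [(isClosed_tsupport χ).isOpen_compl.mem_nhds hyt] with z hz
    rw [image_eq_zero_of_notMem_tsupport hz, zero_smul]

variable [IsManifold (𝓡 n) ∞ M]

theorem exists_bump [T2Space M] {x : M} {U : Set M} (hU : U ∈ nhds x) :
    ∃ χ : M → ℝ, ContMDiff (𝓡 n) 𝓘(ℝ, ℝ) ∞ χ ∧ tsupport χ ⊆ U ∧ ∀ᶠ y in nhds x, χ y = 1 := by
  obtain ⟨χ, -, hχ⟩ := (SmoothBumpFunction.nhds_basis_tsupport (I := 𝓡 n) x).mem_iff.1 hU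
  exact ⟨χ, χ.contMDiff, hχ, χ.eventuallyEq_one⟩

theorem exists_contMDiff_eventuallyEq [T2Space M] {G : Type*} [NormedAddCommGroup G]
    [NormedSpace ℝ G] {h : M → G} {U : Set M} (hU : IsOpen U)
    (hh : ContMDiffOn (𝓡 n) 𝓘(ℝ, G) ∞ h U) {x : M} (hx : x ∈ U) :
    ∃ h' : M → G, ContMDiff (𝓡 n) 𝓘(ℝ, G) ∞ h' ∧ h' =ᶠ[nhds x] h := by
  obtain ⟨χ, hχ, hχU, hχ1⟩ := exists_bump (n := n) (hU.mem_nhds hx)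
  refine ⟨fun y => χ y • h y, contMDiffOn_univ.1
    (contMDiffOn_smul_of_tsupport hχ isOpen_univ hU hχU (by rwa [Set.univ_inter])), ?_⟩
  filter_upwards [hχ1] with y hy
  rw [hy, one_smul]

theorem exists_section_trivializationAt_eq [T2Space M] {F : Type*} [NormedAddCommGroup F]
    [NormedSpace ℝ F] {V : M → Type*} [TopologicalSpace (Bundle.TotalSpace F V)]
    [∀ x, TopologicalSpace (V x)] [∀ x, AddCommGroup (V x)] [∀ x, Module ℝ (V x)]
    [FiberBundle F V] [VectorBundle ℝ F V] [ContMDiffVectorBundle ∞ F V (𝓡 n)]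
    {φ : M → F} {U : Set M} (hU : IsOpen U) (hφ : ContMDiffOn (𝓡 n) 𝓘(ℝ, F) ∞ φ U) {x : M}
    (hx : x ∈ U) : ∃ s : ContMDiffSection (𝓡 n) F ∞ V,
      ∀ᶠ y in nhds x, (trivializationAt F V x ⟨y, s y⟩).2 = φ y := by
  set e := trivializationAt F V x
  have hO : IsOpen (U ∩ e.baseSet) := hU.inter e.open_baseSet
  have hxO : x ∈ U ∩ e.baseSet := ⟨hx, FiberBundle.mem_baseSet_trivializationAt' x⟩
  obtain ⟨χ, hχ, hχU, hχ1⟩ := exists_bump (n := n) (hO.mem_nhds hxO)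
  have hsm : ContMDiffOn (𝓡 n) ((𝓡 n).prod 𝓘(ℝ, F)) ∞
      (fun y => Bundle.TotalSpace.mk' F y (e.symm y (φ y))) (U ∩ e.baseSet) := by
    rw [e.contMDiffOn_section_iff hO Set.inter_subset_right]
    refine (hφ.mono Set.inter_subset_left).congr fun y hy => ?_
    rw [e.apply_mk_symm hy.2]
  refine ⟨⟨χ • fun y => e.symm y (φ y), ContMDiffOn.smul_section_of_tsupport
    hχ.contMDiffOn hO hχU hsm⟩, ?_⟩
  filter_upwards [hχ1, hO.mem_nhds hxO] with y hy hyO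
  change (e ⟨y, χ y • e.symm y (φ y)⟩).2 = φ y
  rw [hy, one_smul, e.apply_mk_symm hyO.2]

theorem exists_vecComp_eq [T2Space M] (x : M) (v : 𝔼) :
    ∃ W : VecField n M, ∀ᶠ y in nhds x, vecComp x (W y) = v :=
  exists_section_trivializationAt_eq isOpen_univ contMDiffOn_const trivial

variable {V : M → Type*} [TopologicalSpace (Bundle.TotalSpace (Fin m → ℝ) V)]
  [∀ x, TopologicalSpace (V x)] [FiberBundle (Fin m → ℝ) V]

/-- The pullback of a function on the base. -/
def baseFun {h : M → ℝ} (hh : ContMDiff (𝓡 n) 𝓘(ℝ, ℝ) ∞ h) : JetFun n m V :=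
  ⟨fun ρ => h ρ.base, mem_jetFun_iff.2 ⟨0, isOfOrder_base hh⟩⟩

theorem derivation_apply_eq_of_eventuallyEq [T2Space M] {f g : JetFun n m V} {ρ : Jet n m V}
    (h : ∀ᶠ y in nhds ρ.base, ∀ σ, f.1 (jet y σ) = g.1 (jet y σ)) (X : JetField n m V) :
    (X f).1 ρ = (X g).1 ρ := by
  obtain ⟨ψ, hψ, hψs, hψ1⟩ := exists_bump (n := n) h
  have hzero : baseFun hψ * (f - g) = 0 := by
    refine jetFun_ext fun y σ => ?_
    change ψ y * (f.1 (jet y σ) - g.1 (jet y σ)) = 0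
    by_cases hy : y ∈ tsupport ψ
    · rw [hψs hy σ, sub_self, mul_zero]
    · rw [image_eq_zero_of_notMem_tsupport hy, zero_mul]
  have hone : evalAt ρ (baseFun hψ) = 1 := hψ1.self_of_nhds
  have hfg : evalAt ρ (f - g) = 0 := by
    obtain ⟨σ, hσ⟩ := exists_jet_eq ρ
    rw [map_sub, evalAt_apply, evalAt_apply, ← hσ, h.self_of_nhds σ, sub_self]
  have hX : evalAt ρ (X (baseFun hψ * (f - g))) = 0 := by rw [hzero, map_zero, map_zero]
  rwa [Derivation.leibniz, smul_eq_mul, smul_eq_mul, map_add, map_mul, map_mul, hone, hfg, one_mul,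
    zero_mul, add_zero, map_sub, map_sub, sub_eq_zero] at hX

end Germs

section AdaptedCoordinates

variable {n m : ℕ} {M : Type*} [TopologicalSpace M] [ChartedSpace (EuclideanSpace ℝ (Fin n)) M]
  {V : M → Type*} [TopologicalSpace (Bundle.TotalSpace (Fin m → ℝ) V)]
  [∀ x, TopologicalSpace (V x)] [FiberBundle (Fin m → ℝ) V]

local notation "𝔼" => EuclideanSpace ℝ (Fin n)
local notation "ch" => chartAt (EuclideanSpace ℝ (Fin n))

theorem exists_smooth_expression (f : JetFun n m V) (x : M) :
    ∃ (k : ℕ) (H : 𝔼 × (Fin m → multiIdx n k → ℝ) → ℝ), ContDiff ℝ ∞ H ∧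
      ∀ᶠ y in nhds x, ∀ σ, f.1 (jet y σ) = H (ch x y, jetVec k x σ (ch x y)) := by
  obtain ⟨k, hk⟩ := exists_local_expression f
  obtain ⟨g, hg, hfg⟩ := hk x
  obtain ⟨κ, hκ, hκs, hκ1⟩ := exists_bump (n := n)
    ((isOpen_coordDom V x).mem_nhds
      (chart_mem_coordDom (mem_adaptedDom_self (n := n) (m := m) V x)))
  have hH : ContDiff ℝ ∞ fun p : 𝔼 × (Fin m → multiIdx n k → ℝ) => κ p.1 * g p := by
    refine contDiff_iff_contDiffAt.2 fun p => ?_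
    by_cases hp : p.1 ∈ tsupport κ
    · exact ((contMDiff_iff_contDiff.1 hκ).comp contDiff_fst).contDiffAt.mul
        (hg.contDiffAt ((isOpen_coordDom_prod_univ x k).mem_nhds ⟨hκs hp, trivial⟩))
    · refine (contDiffAt_const (c := (0 : ℝ))).congr_of_eventuallyEq ?_
      filter_upwards [continuous_fst.continuousAt.eventually
        ((isClosed_tsupport κ).isOpen_compl.mem_nhds hp)] with q hq
      rw [image_eq_zero_of_notMem_tsupport hq, zero_mul]
  refine ⟨k, _, hH, ?_⟩
  filter_upwards [(isOpen_adaptedDom V x).mem_nhds (mem_adaptedDom_self (n := n) (m := m) V x),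
    ((ch x).continuousAt (mem_chart_source _ x)).eventually hκ1] with y hy hκy σ
  simp only [hκy, one_mul, ← hfg _ (chart_mem_coordDom hy) σ, (ch x).left_inv hy.1]

variable (n m V) in
/-- Functions on the whole jet space which agree with the adapted coordinates on the jets over a
neighbourhood of `x`. Global functions are needed since fields act only on these. -/
structure AdaptedCoords (x : M) where
  base : Fin n → JetFun n m V
  fibre : Fin m → (Fin n → ℕ) → JetFun n m V
  base_eq : ∀ a, ∀ᶠ y in nhds x, ∀ σ, (base a).1 (jet y σ) = ch x y a
  fibre_eq : ∀ i α, ∀ᶠ y in nhds x, ∀ σ, (fibre i α).1 (jet y σ) = jetCoord n m V x σ y i α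

variable [IsManifold (𝓡 n) ∞ M]

theorem exists_order_apply_eq_zero [T2Space M] {ρ : Jet n m V} (C : AdaptedCoords n m V ρ.base)
    (f : JetFun n m V) : ∃ k, ∀ X : JetField n m V, (∀ a, (X (C.base a)).1 ρ = 0) →
      (∀ i, ∀ α ∈ multiIdx n k, (X (C.fibre i α)).1 ρ = 0) → (X f).1 ρ = 0 := by
  obtain ⟨k, H, hH, hf⟩ := exists_smooth_expression f ρ.base
  let G : Fin n ⊕ (Fin m × multiIdx n k) → JetFun n m V :=
    Sum.elim C.base fun q => C.fibre q.1 q.2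
  have hH' : ContDiff ℝ ∞ fun z : Fin n ⊕ (Fin m × multiIdx n k) → ℝ =>
      H (WithLp.toLp 2 fun a => z (Sum.inl a), fun i α => z (Sum.inr (i, α))) :=
    hH.comp (by fun_prop)
  obtain ⟨c, hc⟩ := exists_chain_rule hH' G ρ
  refine ⟨k, fun X hbase hfibre => ?_⟩
  have hgerm : ∀ᶠ y in nhds ρ.base, ∀ σ, f.1 (jet y σ) = (smoothComp hH' G).1 (jet y σ) := by
    filter_upwards [hf, Filter.eventually_all.2 C.base_eq, Filter.eventually_all.2 fun i =>
      Filter.eventually_all.2 fun α : multiIdx n k => C.fibre_eq i α] with y hy hb hu σ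
    rw [hy σ, smoothComp_apply]
    congr 1
    refine Prod.ext ?_ ?_
    · ext a
      exact (hb a σ).symm
    · funext i α
      exact (hu i α σ).symm
  rw [derivation_apply_eq_of_eventuallyEq hgerm, hc]
  refine Finset.sum_eq_zero fun q _ => mul_eq_zero_of_right _ ?_
  rcases q with a | ⟨i, α⟩
  · exact hbase a
  · exact hfibre i α α.2

theorem exists_jetFun_eq_baseCoord [T2Space M] (x : M) (a : Fin n) :
    ∃ b : JetFun n m V, ∀ᶠ y in nhds x, ∀ σ, b.1 (jet y σ) = ch x y a := by
  obtain ⟨h, hh, hhx⟩ := exists_contMDiff_eventuallyEq (h := fun y => ch x y a)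
    (ch x).open_source ((contDiff_piLp_apply 2).contMDiff.comp_contMDiffOn
      (contMDiffOn_chart (I := 𝓡 n) (x := x) (n := ∞))) (mem_chart_source _ x)
  refine ⟨baseFun hh, ?_⟩
  filter_upwards [hhx] with y hy _
  exact hy

variable [∀ x, AddCommGroup (V x)] [∀ x, Module ℝ (V x)] [VectorBundle ℝ (Fin m → ℝ) V]
  [ContMDiffVectorBundle ∞ (Fin m → ℝ) V (𝓡 n)]

namespace AdaptedCoords

variable {x : M} (C : AdaptedCoords n m V x) (σ : Sec n m V)

theorem cartanLift_base (W : VecField n M) (a : Fin n) :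
    (cartanLift W (C.base a)).1 (jet x σ) = vecComp x (W x) a := by
  have hx := mem_chart_source 𝔼 x
  have heq : (fun z => (C.base a).1 (jet ((ch x).symm z) σ)) =ᶠ[nhds (ch x x)] fun z => z a := by
    filter_upwards [((ch x).eventually_nhds' _ hx).2 (C.base_eq a),
      (ch x).open_target.mem_nhds ((ch x).map_source hx)] with z hz hzt
    rw [hz σ, (ch x).right_inv hzt]
  rw [cartanLift_apply_eq_fderiv hx, heq.fderiv_eq]
  exact congrArg (fun L : 𝔼 →L[ℝ] ℝ => L (vecComp x (W x)))
    (EuclideanSpace.proj a : 𝔼 →L[ℝ] ℝ).hasFDerivAt.fderiv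

theorem translationField_base (τ : Sec n m V) (a : Fin n) :
    (translationField τ (C.base a)).1 (jet x σ) = 0 := by
  simp only [translationField_apply, (C.base_eq a).self_of_nhds, deriv_const]

theorem translationField_fibre (τ : Sec n m V) (i : Fin m) (α : Fin n → ℕ) :
    (translationField τ (C.fibre i α)).1 (jet x σ) = jetCoord n m V x τ x i α := by
  have hlin : ∀ ε : ℝ, jetCoord n m V x (σ + ε • τ : Sec n m V) x i α =
      jetCoord n m V x σ x i α + ε * jetCoord n m V x τ x i α := fun ε =>
    iterOps_basePartial_localComp_add_smul x σ τ ε i α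
      (chart_mem_coordDom (mem_adaptedDom_self V x))
  simp only [translationField_apply, (C.fibre_eq i α).self_of_nhds, hlin]
  simp

end AdaptedCoords

theorem isOfOrder_fibreCoord {x₁ : M} {χ : M → ℝ} (hχ : ContMDiff (𝓡 n) 𝓘(ℝ, ℝ) ∞ χ)
    (hs : tsupport χ ⊆ adaptedDom n m V x₁) (i : Fin m) : IsOfOrder 0 fun y (σ : Sec n m V) =>
      χ y * (trivializationAt (Fin m → ℝ) V x₁ ⟨y, σ y⟩).2 i := by
  intro x₀
  set e₀ := trivializationAt (Fin m → ℝ) V x₀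
  set e₁ := trivializationAt (Fin m → ℝ) V x₁
  let T (y : M) : (Fin m → ℝ) →L[ℝ] (Fin m → ℝ) := χ y • (e₀.coordChangeL ℝ e₁ y : _ →L[ℝ] _)
  have hT : ContDiffOn ℝ ∞ (fun z => T ((ch x₀).symm z)) (coordDom n m V x₀) :=
    contDiffOn_comp_chart_symm x₀ (adaptedDom_subset_source V x₀)
      (contMDiffOn_smul_of_tsupport hχ (isOpen_adaptedDom V x₀) (isOpen_adaptedDom V x₁) hs
        ((contMDiffOn_coordChangeL e₀ e₁).mono fun y hy => ⟨hy.1.2, hy.2.2⟩))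
  have h0 : (0 : Fin n → ℕ) ∈ multiIdx n 0 := by simp [multiIdx]; rfl
  refine ⟨fun p => T ((ch x₀).symm p.1) (fun j => p.2 j ⟨0, h0⟩) i,
    contDiffOn_pi.1 ((hT.comp contDiffOn_fst fun p hp => hp.1).clm_apply
      (ContDiff.contDiffOn (by fun_prop))) i, fun y hy σ => ?_⟩
  have hu : (fun j => jetVec 0 x₀ σ (ch x₀ y) j ⟨0, h0⟩) = (e₀ ⟨y, σ y⟩).2 := by
    funext j
    rw [jetVec, iterOps_zero, localComp_chart hy]
  simp only [hu, (ch x₀).left_inv hy.1]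
  by_cases hy₁ : y ∈ adaptedDom n m V x₁
  · have hchange : e₀.coordChangeL ℝ e₁ y (e₀ ⟨y, σ y⟩).2 = (e₁ ⟨y, σ y⟩).2 := by
      rw [e₀.coordChangeL_apply e₁ ⟨hy.2, hy₁.2⟩, e₀.symm_apply_apply_mk hy.2]
    exact congrArg (χ y * ·) (congrFun hchange i).symm
  · simp [T, image_eq_zero_of_notMem_tsupport fun h => hy₁ (hs h)]

variable [T2Space M]

theorem exists_jetFun_eq_fibreCoord (x : M) (i : Fin m) : ∃ q : JetFun n m V,
    ∀ᶠ y in nhds x, ∀ σ, q.1 (jet y σ) = (trivializationAt (Fin m → ℝ) V x ⟨y, σ y⟩).2 i := by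
  obtain ⟨χ, hχ, hs, hχ1⟩ := exists_bump (n := n)
    ((isOpen_adaptedDom V x).mem_nhds (mem_adaptedDom_self (n := n) (m := m) V x))
  refine ⟨⟨descend _, descend_mem_jetFun (isOfOrder_fibreCoord hχ hs i)⟩, ?_⟩
  filter_upwards [hχ1] with y hy σ
  exact (descend_jet (isOfOrder_fibreCoord hχ hs i) y σ).trans (by rw [hy, one_mul])

-- `uⁱ_α` is obtained from `uⁱ` by total derivatives along extensions of the coordinate fields.
theorem exists_jetFun_eq_jetCoord (x : M) (i : Fin m) (α : Fin n → ℕ) : ∃ u : JetFun n m V,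
    ∀ᶠ y in nhds x, ∀ σ, u.1 (jet y σ) = jetCoord n m V x σ y i α := by
  obtain ⟨q, hq⟩ := exists_jetFun_eq_fibreCoord (n := n) (V := V) x i
  choose W hW using fun j : Fin n => exists_vecComp_eq x (EuclideanSpace.single j (1 : ℝ))
  obtain ⟨N, hN, hNo, hxN⟩ := eventually_nhds_iff.1 ((hq.and (Filter.eventually_all.2 hW)).and
    ((isOpen_adaptedDom V x).mem_nhds (mem_adaptedDom_self (n := n) (m := m) V x)))
  have hO := isOpen_coordDom (n := n) (m := m) V x
  have hchN : IsOpen (ch x '' N) :=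
    (ch x).isOpen_image_of_subset_source hNo fun y hy => (hN y hy).2.1
  refine ⟨iterOps (fun j f => cartanLift (W j) f) α q, ?_⟩
  filter_upwards [hNo.mem_nhds hxN] with y hy σ
  refine (iterOps_rel (T' := basePartial) (fun (f : JetFun n m V) h =>
    ContDiffOn ℝ ∞ h (coordDom n m V x) ∧ ∀ y ∈ N, f.1 (jet y σ) = h (ch x y)) ?_ α
    ⟨contDiffOn_localComp x σ i, fun y hy => ?_⟩).2 y hy
  · rintro j f h ⟨hh, hf⟩
    refine ⟨contDiffOn_basePartial hO hh j, fun y hy => ?_⟩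
    have heq : (fun z => f.1 (jet ((ch x).symm z) σ)) =ᶠ[nhds (ch x y)] h := by
      filter_upwards [hchN.mem_nhds ⟨y, hy, rfl⟩] with z ⟨q, hq, hqz⟩
      rw [← hqz, (ch x).left_inv (hN q hq).2.1, hf q hq]
    rw [cartanLift_apply_eq_fderiv (hN y hy).2.1, (hN y hy).1.2 j, heq.fderiv_eq,
      basePartial_eq_fderiv hO hh (chart_mem_coordDom (hN y hy).2)]
  · rw [(hN y hy).1.1 σ, localComp_chart (hN y hy).2]

variable (n m V) in
theorem nonempty_adaptedCoords (x : M) : Nonempty (AdaptedCoords n m V x) := by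
  choose b hb using exists_jetFun_eq_baseCoord (n := n) (m := m) (V := V) x
  choose u hu using exists_jetFun_eq_jetCoord (n := n) (m := m) (V := V) x
  exact ⟨⟨b, u, hb, hu⟩⟩

theorem exists_section_jetCoord_eq (x : M) (k : ℕ) (c : Fin m → (Fin n → ℕ) → ℝ) :
    ∃ τ : Sec n m V, ∀ i, ∀ α ∈ multiIdx n k, jetCoord n m V x τ x i α = c i α := by
  choose h hh hα using fun i => exists_iterOps_basePartial_eq (ch x x) (multiIdx n k) (c i)
  obtain ⟨τ, hτ⟩ := exists_section_trivializationAt_eq (V := V) (φ := fun y i => h i (ch x y))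
    (ch x).open_source ((contDiff_pi.2 hh).contMDiff.comp_contMDiffOn
      (contMDiffOn_chart (I := 𝓡 n) (x := x) (n := ∞))) (mem_chart_source _ x)
  obtain ⟨N, hN, hNo, hxN⟩ := eventually_nhds_iff.1
    (hτ.and ((isOpen_adaptedDom V x).mem_nhds (mem_adaptedDom_self (n := n) (m := m) V x)))
  have hchN : IsOpen (ch x '' N) :=
    (ch x).isOpen_image_of_subset_source hNo fun y hy => (hN y hy).2.1
  have heq : ∀ i, Set.EqOn (localComp x τ i) (h i) (ch x '' N) := by
    rintro i _ ⟨y, hy, rfl⟩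
    rw [localComp_chart (hN y hy).2, (hN y hy).1]
  refine ⟨τ, fun i α hαk => ?_⟩
  exact (iterOps_basePartial_congr hchN (heq i) α ⟨x, hxN, rfl⟩).trans ((hα i α).trans (if_pos hαk))

theorem exists_decomposition {ι : Type*} [Finite ι] (X : JetField n m V) (ρ : Jet n m V)
    (g : ι → JetFun n m V) : ∃ (W : VecField n M) (τ : Sec n m V), ∀ j,
      evalAt ρ (X (g j)) = evalAt ρ (cartanLift W (g j)) + evalAt ρ (translationField τ (g j)) := by
  have := Fintype.ofFinite ι
  obtain ⟨C⟩ := nonempty_adaptedCoords n m V ρ.base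
  obtain ⟨σ, hσ⟩ := exists_jet_eq ρ
  choose k hk using fun j => exists_order_apply_eq_zero C (g j)
  obtain ⟨W, hW⟩ := exists_vecComp_eq ρ.base (WithLp.toLp 2 fun a => (X (C.base a)).1 ρ)
  obtain ⟨τ, hτ⟩ := exists_section_jetCoord_eq (V := V) ρ.base (Finset.univ.sup k) fun i α =>
    (X (C.fibre i α)).1 ρ - (cartanLift W (C.fibre i α)).1 ρ
  refine ⟨W, τ, fun j => ?_⟩
  have hzero := hk j (X - (cartanLift W + translationField τ)) (fun a => ?_) fun i α hα => ?_
  · exact sub_eq_zero.1 hzero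
  · change (X _).1 ρ - ((cartanLift W _).1 ρ + (translationField τ _).1 ρ) = 0
    have h₁ := C.cartanLift_base σ W a
    have h₂ := C.translationField_base σ τ a
    rw [hσ] at h₁ h₂
    rw [h₁, h₂, hW.self_of_nhds, add_zero, sub_self]
  · change (X _).1 ρ - ((cartanLift W _).1 ρ + (translationField τ _).1 ρ) = 0
    have h := C.translationField_fibre σ τ i α
    rw [hσ, hτ i α (multiIdx_mono (Finset.le_sup (Finset.mem_univ j)) hα)] at h
    rw [h]
    ring

end AdaptedCoordinates

end JetGeom

namespace DiffCalc

section CartanFormula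

variable {A : Type*} [CommRing A] [Algebra ℝ A]

theorem forms_apply_comp_perm {k : ℕ} {θ : Cochain A k} (hθ : θ ∈ Forms A k)
    (X : Fin k → Derivation ℝ A A) (σ : Equiv.Perm (Fin k)) :
    θ (X ∘ σ) = Equiv.Perm.sign σ • θ X := by
  obtain ⟨Φ, hΦ⟩ := exists_alternatingMap_eq hθ
  rw [hΦ, hΦ]
  exact Φ.map_perm (fun a => ⇑(X a)) σ

theorem forms_apply_eq_zero {k : ℕ} {θ : Cochain A k} (hθ : θ ∈ Forms A k)
    {X : Fin k → Derivation ℝ A A} {a : Fin k} (ha : X a = 0) : θ X = 0 := by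
  obtain ⟨Φ, hΦ⟩ := exists_alternatingMap_eq hθ
  rw [hΦ]
  exact Φ.map_coord_zero a (by rw [ha, Derivation.coe_zero])

theorem lieDer_apply_eq_zero {k : ℕ} {θ : Cochain A k} (hθ : θ ∈ Forms A k) {X : Derivation ℝ A A}
    {Y : Fin k → Derivation ℝ A A} (hY : θ Y = 0) (hXY : ∀ a, ⁅X, Y a⁆ = 0) :
    lieDer X θ Y = 0 := by
  rw [lieDer, hY, map_zero, zero_sub, neg_eq_zero]
  refine Finset.sum_eq_zero fun a _ => forms_apply_eq_zero hθ (a := a) ?_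
  rw [Function.update_self, hXY]

theorem extDContract_eq_zero {k : ℕ} {θ : Cochain A k} {X : Derivation ℝ A A}
    (h : ∀ Y : Fin k → Derivation ℝ A A, (∃ a, Y a = X) → θ Y = 0) : extDContract X θ = 0 := by
  cases k with
  | zero => rfl
  | succ k =>
    have hX : contract X θ = 0 := funext fun Z => h _ ⟨0, rfl⟩
    rw [extDContract, hX]
    simpa only [zero_smul] using extD_smul k 0 (0 : Cochain A k)

theorem extD_apply_cons {k : ℕ} (θ : Cochain A k) (X : Derivation ℝ A A)
    (Y : Fin k → Derivation ℝ A A) :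
    extD k θ (Fin.cons X Y) = lieDer X θ Y - extDContract X θ Y := by
  cases k with
  | zero => simp [extD, lieDer, extDContract]
  | succ k => rfl

theorem restrictForm_surjective (I : Ideal A) (k : ℕ) : Function.Surjective (restrictForm I k) :=
  Submodule.mkQ_surjective _

end CartanFormula

end DiffCalc

namespace JetGeom

open DiffCalc

section CartanIdeal

variable {n m : ℕ} {M : Type*} [TopologicalSpace M] [ChartedSpace (EuclideanSpace ℝ (Fin n)) M]
  {V : M → Type*} [TopologicalSpace (Bundle.TotalSpace (Fin m → ℝ) V)]
  [∀ x, TopologicalSpace (V x)] [FiberBundle (Fin m → ℝ) V]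

local notation "𝔼" => EuclideanSpace ℝ (Fin n)

theorem IsLiftAt.evalAt_eq {X Y : JetField n m V} {ρ : Jet n m V} {v : TangentSpace (𝓡 n) ρ.base}
    (hX : IsLiftAt X ρ v) (hY : IsLiftAt Y ρ v) (f : JetFun n m V) :
    evalAt ρ (X f) = evalAt ρ (Y f) := by
  obtain ⟨σ, hσ⟩ := exists_jet_eq ρ
  exact (hX _ σ hσ f).trans (hY _ σ hσ f).symm

theorem inCartanPowAt_one_of_lt {k : ℕ} (hk : n < k) {η : Cochain (JetFun n m V) k}
    (hη : η ∈ Forms (JetFun n m V) k) (ρ : Jet n m V) : InCartanPowAt 1 η ρ := by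
  intro X s hcard hX
  have hs : s = Finset.univ := s.eq_univ_of_card
    (s.card_le_univ.antisymm (by rw [Fintype.card_fin]; omega))
  subst hs
  choose! v hv using hX
  obtain ⟨σ, hσ⟩ := exists_jet_eq ρ
  obtain ⟨N, g, Φ, hΦ⟩ := exists_alternatingMap_of_mem_forms hη (evalAt ρ)
  let T : 𝔼 →ₗ[ℝ] Fin N × Fin k → ℝ := LinearMap.pi fun i => ContinuousLinearMap.toLinearMap
    (mfderiv (𝓡 n) 𝓘(ℝ, ℝ) (fun y => (g i).1 (jet y σ)) ρ.base : 𝔼 →L[ℝ] ℝ)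
  have hT : (fun a i => evalAt ρ (X a (g i))) = T ∘ v :=
    funext₂ fun a i => hv a (Finset.mem_univ a) ρ.base σ hσ (g i)
  refine (hΦ X).trans (hT ▸ Φ.map_linearDependent (T ∘ v) fun h => ?_)
  simpa [hk.not_ge] using (LinearIndependent.of_comp T h).fintype_card_le_finrank

theorem exists_forall_ne_mem_of_card {ι : Type*} [Fintype ι] [Nonempty ι] {s : Finset ι}
    (hs : Fintype.card ι ≤ s.card + 1) : ∃ i, ∀ j, j ≠ i → j ∈ s := by
  classical
  obtain ⟨i, hi⟩ := Finset.card_le_one_iff_subset_singleton.1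
    (show sᶜ.card ≤ 1 by rw [Finset.card_compl]; omega)
  exact ⟨i, fun j hj => by_contra fun h =>
    hj (Finset.mem_singleton.1 (hi (Finset.mem_compl.2 h)))⟩

theorem inCartanPowAt_two_of_succ {k : ℕ} {η : Cochain (JetFun n m V) (k + 1)}
    (hη : η ∈ Forms (JetFun n m V) (k + 1)) {ρ : Jet n m V}
    (h : ∀ X : Fin (k + 1) → JetField n m V, (∀ a : Fin k, IsCartanAt (X a.succ) ρ) →
      (η X).1 ρ = 0) : InCartanPowAt 2 η ρ := by
  intro X s hcard hX
  obtain ⟨i, hi⟩ := exists_forall_ne_mem_of_card (s := s) (by rw [Fintype.card_fin]; omega)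
  have hswap : (η (X ∘ Equiv.swap 0 i)).1 ρ = 0 := h _ fun a => hX _ <| hi _ fun ha =>
    a.succ_ne_zero (by rwa [Equiv.swap_apply_eq_iff, Equiv.swap_apply_right] at ha)
  rw [forms_apply_comp_perm hη] at hswap
  rcases Int.units_eq_one_or (Equiv.Perm.sign (Equiv.swap 0 i)) with hs | hs <;>
    simpa [hs] using hswap

variable [IsManifold (𝓡 n) ∞ M] [∀ x, AddCommGroup (V x)] [∀ x, Module ℝ (V x)]
  [VectorBundle ℝ (Fin m → ℝ) V] [ContMDiffVectorBundle ∞ (Fin m → ℝ) V (𝓡 n)]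

theorem exists_isLiftAt_cartanLift [T2Space M] (ρ : Jet n m V) (v : TangentSpace (𝓡 n) ρ.base) :
    ∃ W : VecField n M, IsLiftAt (cartanLift W) ρ v := by
  obtain ⟨W, hW⟩ := exists_vecComp_eq ρ.base (vecComp ρ.base v)
  refine ⟨W, ?_⟩
  rintro x σ rfl f
  have hx := mem_chart_source 𝔼 x
  refine (cartanLift_apply_eq_fderiv hx W f σ).trans ?_
  exact hW.self_of_nhds ▸
    (mfderiv_apply_eq_fderiv_vecComp hx (mdifferentiableAt_comp_jet f x σ) v).symm

end CartanIdeal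

section Presymplectic

variable {n m : ℕ} {M : Type*} [TopologicalSpace M] [ChartedSpace (EuclideanSpace ℝ (Fin n)) M]
  [IsManifold (𝓡 n) ∞ M] {V : M → Type*} [TopologicalSpace (Bundle.TotalSpace (Fin m → ℝ) V)]
  [∀ x, TopologicalSpace (V x)] [FiberBundle (Fin m → ℝ) V] [∀ x, AddCommGroup (V x)]
  [∀ x, Module ℝ (V x)] [VectorBundle ℝ (Fin m → ℝ) V] [ContMDiffVectorBundle ∞ (Fin m → ℝ) V (𝓡 n)]

theorem lieDer_translationField_cartanLift {k : ℕ} {θ : Cochain (JetFun n m V) k}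
    (hθ : θ ∈ Forms (JetFun n m V) k) (hθ₁ : ∀ ρ, InCartanPowAt 1 θ ρ) (τ : Sec n m V)
    (W : Fin k → VecField n M) :
    lieDer (translationField τ) θ (fun a => cartanLift (W a)) = 0 :=
  lieDer_apply_eq_zero hθ
    (jetFun_ext fun x σ => hθ₁ (jet x σ) _ Finset.univ (by simp) fun a _ =>
      isCartanAt_cartanLift (W a) (jet x σ))
    fun a => lie_translationField_cartanLift τ (W a)

theorem extDContract_translationField_eq_zero {k : ℕ} {L : Cochain (JetFun n m V) k}
    (hL : IsHorizontal L) (τ : Sec n m V) : extDContract (translationField τ) L = 0 := by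
  refine extDContract_eq_zero ?_
  rintro Y ⟨a, ha⟩
  exact jetFun_ext fun x σ => hL Y (jet x σ) ⟨a, ha ▸ isVerticalAt_translationField τ _⟩

theorem evalAt_extD_cons_translationField {L θ : Cochain (JetFun n m V) n}
    (hθF : θ ∈ Forms (JetFun n m V) n) (hL : IsHorizontal L) (hθ : IsNoetherForm L θ)
    {ρ : Jet n m V} (hE : ∀ w v, eulerForm L ρ w v = 0) (τ : Sec n m V)
    (W : Fin n → VecField n M) :
    evalAt ρ (extD n (L + θ) (Fin.cons (translationField τ) fun a => cartanLift (W a))) = 0 := by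
  let Y : Fin n → JetField n m V := fun a => cartanLift (W a)
  have hNoether : (lieDer (translationField τ) L Y).1 ρ =
      eulerForm L ρ (τ ρ.base) (fun a => W a ρ.base) +
        (extDContract (translationField τ) θ Y).1 ρ :=
    hθ.2.2 (pullbackSection τ) _ (isEvolutionary_translationField τ) ρ Y _
      fun a => isLiftAt_cartanLift (W a) ρ
  rw [hE, zero_add] at hNoether
  rw [extD_add, Pi.add_apply, extD_apply_cons, extD_apply_cons,
    extDContract_translationField_eq_zero hL, lieDer_translationField_cartanLift hθF hθ.1,
    Pi.zero_apply, sub_zero, zero_sub, ← sub_eq_add_neg, map_sub]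
  exact sub_eq_zero.2 hNoether

theorem inCartanPowAt_two_extD [T2Space M] {L θ : Cochain (JetFun n m V) n}
    (hLF : L ∈ Forms (JetFun n m V) n) (hθF : θ ∈ Forms (JetFun n m V) n) (hL : IsHorizontal L)
    (hθ : IsNoetherForm L θ) {ρ : Jet n m V} (hE : ∀ w v, eulerForm L ρ w v = 0) :
    InCartanPowAt 2 (extD n (L + θ)) ρ := by
  have hη := extD_mem_forms (Submodule.add_mem _ hLF hθF)
  refine inCartanPowAt_two_of_succ hη fun X hX => ?_
  obtain ⟨N, g, Φ, hΦ⟩ := exists_alternatingMap_of_mem_forms hη (evalAt ρ)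
  obtain ⟨W₀, τ, hX₀⟩ := exists_decomposition (X 0) ρ g
  choose v hv using hX
  choose W hW using fun a => exists_isLiftAt_cartanLift ρ (v a)
  let row (Z : JetField n m V) (i : Fin N × Fin (n + 1)) : ℝ := evalAt ρ (Z (g i))
  have hrows : (fun a => row (X a)) = Fin.cons (row (cartanLift W₀) + row (translationField τ))
      fun a => row (cartanLift (W a)) :=
    funext <| Fin.cases (funext hX₀) fun a => funext fun i => (hv a).evalAt_eq (hW a) (g i)
  have hcons (Z : JetField n m V) : Φ (Fin.cons (row Z) fun a => row (cartanLift (W a))) =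
      evalAt ρ (extD n (L + θ) (Fin.cons Z fun a => cartanLift (W a))) :=
    (congrArg Φ (funext <| Fin.cases rfl fun _ => rfl)).trans (hΦ _).symm
  have hcartan : evalAt ρ (extD n (L + θ) (Fin.cons (cartanLift W₀) fun a => cartanLift (W a))) =
      0 :=
    inCartanPowAt_one_of_lt n.lt_succ_self hη ρ _ Finset.univ (by simp) fun a _ =>
      Fin.cases (isCartanAt_cartanLift W₀ ρ) (fun a => isCartanAt_cartanLift (W a) ρ) a
  calc evalAt ρ (extD n (L + θ) X)
      = Φ (Fin.cons (row (cartanLift W₀) + row (translationField τ))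
          fun a => row (cartanLift (W a))) := (hΦ X).trans (congrArg Φ hrows)
    _ = Φ (Fin.cons (row (cartanLift W₀)) fun a => row (cartanLift (W a))) +
          Φ (Fin.cons (row (translationField τ)) fun a => row (cartanLift (W a))) :=
        Φ.toMultilinearMap.cons_add _ _ _
    _ = 0 := by
        rw [hcons, hcons, hcartan, evalAt_extD_cons_translationField hθF hL hθ hE, add_zero]

end Presymplectic

section CartanFiltration

variable {n m : ℕ} {M : Type*} [TopologicalSpace M] [ChartedSpace (EuclideanSpace ℝ (Fin n)) M]
  {V : M → Type*} [TopologicalSpace (Bundle.TotalSpace (Fin m → ℝ) V)]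
  [∀ x, TopologicalSpace (V x)] [FiberBundle (Fin m → ℝ) V]

theorem cartanFiltration_antitone (S : Set (Jet n m V)) (k : ℕ) :
    Antitone fun p => cartanFiltration S p k :=
  fun _ _ hpq => Submodule.map_mono fun _ hθ ρ hρ X s hs hX => hθ ρ hρ X s (by omega) hX

theorem restrictForm_mem_cartanFiltration {S : Set (Jet n m V)} {p k : ℕ}
    {θ : Forms (JetFun n m V) k} (hθ : ∀ ρ ∈ S, InCartanPowAt p θ.1 ρ) :
    restrictForm (vanishingIdeal S) k θ ∈ cartanFiltration S p k :=
  Submodule.mem_map_of_mem hθ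

theorem cartanFiltration_eq_top {S : Set (Jet n m V)} {p k : ℕ}
    (h : ∀ θ : Forms (JetFun n m V) k, ∀ ρ ∈ S, InCartanPowAt p θ.1 ρ) :
    cartanFiltration S p k = ⊤ := by
  refine eq_top_iff.2 fun x _ => ?_
  obtain ⟨θ, rfl⟩ := restrictForm_surjective _ _ x
  exact restrictForm_mem_cartanFiltration (h θ)

theorem cartanFiltration_zero (S : Set (Jet n m V)) (k : ℕ) : cartanFiltration S 0 k = ⊤ :=
  cartanFiltration_eq_top fun _ _ _ _ s hs _ => by
    have hcard := s.card_le_univ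
    rw [Fintype.card_fin] at hcard
    omega

end CartanFiltration

end JetGeom

theorem theorem2_general {n m : ℕ} {M : Type*} [TopologicalSpace M] [T2Space M]
    [ChartedSpace (EuclideanSpace ℝ (Fin n)) M] [IsManifold (𝓡 n) ∞ M]
    (V : M → Type*) [TopologicalSpace (Bundle.TotalSpace (Fin m → ℝ) V)]
    [∀ x, TopologicalSpace (V x)] [∀ x, AddCommGroup (V x)] [∀ x, Module ℝ (V x)]
    [FiberBundle (Fin m → ℝ) V] [VectorBundle ℝ (Fin m → ℝ) V]
    [ContMDiffVectorBundle ∞ (Fin m → ℝ) V (𝓡 n)] (S : Set (JetGeom.Jet n m V))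
    (L θ : JetGeom.JetForms n m V n) (hL : JetGeom.IsHorizontal L.1)
    (hθ : JetGeom.IsNoetherForm L.1 θ.1) (hE : JetGeom.EulerVanishesOn L.1 S) :
    (∃ (Ω : JetGeom.VinE S 1 2 (n + 1)) (e : JetGeom.VinE S 2 2 (n + 1)),
      JetGeom.IsPresymplectic S L θ Ω ∧ JetGeom.vinD S 1 2 (n + 1) Ω = 0 ∧
        DiffCalc.Represents _ _ Ω e) ∧
    ∀ (Ω : JetGeom.VinE S 1 2 (n + 1)) (e : JetGeom.VinE S 2 2 (n + 1)),
      JetGeom.IsPresymplectic S L θ Ω → DiffCalc.Represents _ _ Ω e → e ≠ 0 →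
        ∃ (e₀ : JetGeom.VinE S 0 0 n) (e₁ : JetGeom.VinE S 1 0 n) (e₂ : JetGeom.VinE S 2 0 n),
          DiffCalc.IsClassOf _ _ (DiffCalc.restrictForm (JetGeom.vanishingIdeal S) n L) e₀ ∧
          DiffCalc.Represents _ _ e₀ e₁ ∧ e₁ ≠ 0 ∧
          DiffCalc.Represents _ _ e₁ e₂ ∧ e₂ ≠ 0 := by
  have hd := DiffCalc.dOn_dOn (JetGeom.vanishingIdeal S)
  have hF₁ : JetGeom.cartanFiltration S 1 (n + 1) = ⊤ := JetGeom.cartanFiltration_eq_top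
    fun η ρ _ => JetGeom.inCartanPowAt_one_of_lt n.lt_succ_self η.2 ρ
  have hθ₁ : DiffCalc.restrictForm (JetGeom.vanishingIdeal S) n θ ∈
      JetGeom.cartanFiltration S 1 n :=
    JetGeom.restrictForm_mem_cartanFiltration fun ρ _ => hθ.1 ρ
  have hl : DiffCalc.dOn (JetGeom.vanishingIdeal S) n
      (DiffCalc.restrictForm (JetGeom.vanishingIdeal S) n (L + θ)) ∈
        JetGeom.cartanFiltration S 2 (n + 1) :=
    JetGeom.restrictForm_mem_cartanFiltration (θ := DiffCalc.dForms n (L + θ)) fun ρ hρ =>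
      JetGeom.inCartanPowAt_two_extD L.2 θ.2 hL hθ (hE ρ hρ)
  refine ⟨DiffCalc.exists_represents_d hd 1 hl, fun Ω e hΩ hΩe he => ?_⟩
  refine DiffCalc.exists_represents_ne_zero hd (JetGeom.cartanFiltration_zero S) hF₁ hθ₁ hl
    fun c hc hcl => he ?_
  exact DiffCalc.eq_zero_of_represents_d hd (JetGeom.cartanFiltration_antitone S) (r := 1) hc
    (hcl ▸ hΩ) hΩe

theorem theorem2 {n m l : ℕ} {M : Type*} [TopologicalSpace M] [T2Space M]
    [SecondCountableTopology M] [ChartedSpace (EuclideanSpace ℝ (Fin n)) M]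
    [IsManifold (𝓡 n) ∞ M]
    (V : M → Type*) [TopologicalSpace (Bundle.TotalSpace (Fin m → ℝ) V)]
    [∀ x, TopologicalSpace (V x)] [∀ x, AddCommGroup (V x)] [∀ x, Module ℝ (V x)]
    [FiberBundle (Fin m → ℝ) V] [VectorBundle ℝ (Fin m → ℝ) V]
    [ContMDiffVectorBundle ∞ (Fin m → ℝ) V (𝓡 n)]
    (W : M → Type*) [TopologicalSpace (Bundle.TotalSpace (Fin l → ℝ) W)]
    [∀ x, TopologicalSpace (W x)] [∀ x, AddCommGroup (W x)] [∀ x, Module ℝ (W x)]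
    [FiberBundle (Fin l → ℝ) W] [VectorBundle ℝ (Fin l → ℝ) W]
    [ContMDiffVectorBundle ∞ (Fin l → ℝ) W (𝓡 n)]
    (F : JetGeom.JetSection n m V l W) (S : Set (JetGeom.Jet n m V))
    (hS : S = JetGeom.prolongation F)
    (L θ : JetGeom.JetForms n m V n) (hL : JetGeom.IsHorizontal L.1)
    (hθ : JetGeom.IsNoetherForm L.1 θ.1) (hE : JetGeom.EulerVanishesOn L.1 S) :
    (∃ (Ω : JetGeom.VinE S 1 2 (n + 1)) (e : JetGeom.VinE S 2 2 (n + 1)),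
      JetGeom.IsPresymplectic S L θ Ω ∧ JetGeom.vinD S 1 2 (n + 1) Ω = 0 ∧
        DiffCalc.Represents _ _ Ω e) ∧
    ∀ (Ω : JetGeom.VinE S 1 2 (n + 1)) (e : JetGeom.VinE S 2 2 (n + 1)),
      JetGeom.IsPresymplectic S L θ Ω → DiffCalc.Represents _ _ Ω e → e ≠ 0 →
        ∃ (e₀ : JetGeom.VinE S 0 0 n) (e₁ : JetGeom.VinE S 1 0 n) (e₂ : JetGeom.VinE S 2 0 n),
          DiffCalc.IsClassOf _ _ (DiffCalc.restrictForm (JetGeom.vanishingIdeal S) n L) e₀ ∧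
          DiffCalc.Represents _ _ e₀ e₁ ∧ e₁ ≠ 0 ∧
          DiffCalc.Represents _ _ e₁ e₂ ∧ e₂ ≠ 0 :=
  theorem2_general V S L θ hL hθ hE
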